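/- All vector spaces are real. For a finite-dimensional vector space $V$, let $\lambda(V)=\Lambda^{\dim V}V$ and $\lambda^*(V)=\lambda(V)^*$; for a nonzero element $v$ of a line $L$, let $v^*\in L^*$ be given by $v^*(v)=1$. For a short exact sequence $0\to V'\stackrel{i}{\to}V\stackrel{j}{\to}V''\to0$ of finite-dimensional vector spaces, let $\wedge_V\colon\lambda(V')\otimes\lambda(V'')\to\lambda(V)$ be the isomorphism $$(v_1'\wedge\dots\wedge v_k')\otimes(j(v_1)\wedge\dots\wedge j(v_\ell))\mapsto i(v_1')\wedge\dots\wedge i(v_k')\wedge v_1\wedge\dots\wedge v_\ell .$$ A Fredholm operator $D\colon X\to Y$ between Banach spaces is a bounded linear map with closed image and with finite-dimensional kernel $\kappa(D)$ and cokernel $\mathfrak c(D)=Y/\operatorname{Im}D$. Its determinant line is $\lambda(D)=\lambda(\kappa(D))\otimes\lambda^*(\mathfrak c(D))$, graded by the parity of $\operatorname{ind}D=\dim\kappa(D)-\dim\mathfrak c(D)$. For two such lines, $R\colon\lambda(D_1)\otimes\lambda(D_2)\to\lambda(D_2)\otimes\lambda(D_1)$ is $v_1\otimes v_2\mapsto(-1)^{(\operatorname{ind}D_1)(\operatorname{ind}D_2)}v_2\otimes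 v_1$. An exact triple $\mathfrak t$ of Fredholm operators, written $0\to D'\to D\to D''\to0$, is a commutative diagram of bounded linear maps with exact rows $0\to X'\stackrel{i_X}{\to}X\stackrel{j_X}{\to}X''\to0$ and $0\to Y'\stackrel{i_Y}{\to}Y\stackrel{j_Y}{\to}Y''\to0$ and with Fredholm vertical maps $D',D,D''$. The Snake Lemma gives an exact sequence $$0\to\kappa(D')\stackrel{i_X}{\to}\kappa(D)\stackrel{j_X}{\to}\kappa(D'')\stackrel{\delta}{\to}\mathfrak c(D')\stackrel{i_Y}{\to}\mathfrak c(D)\stackrel{j_Y}{\to}\mathfrak c(D'')\to0,$$ where $\delta(j_X(x))=y'+\operatorname{Im}D'$ if $Dx=i_Y(y')$. Let $\Psi_{\mathfrak t}\colon\lambda(D')\otimes\lambda(D'')\to\lambda(D)$ be the isomorphism determined by $$\Psi_{\mathfrak t}\big(x\otimes(v\wedge w)^*\otimes(u\wedge v)\otimes y^*\big)=(-1)^{\epsilon_{\mathfrak t}}(x\wedge u)\otimes(w\wedge y)^*,\qquad \epsilon_{\mathfrak t}=(\operatorname{ind}D'')\dim\mathfrak c(D')+\dim\mathfrak c(D)\,\dim\operatorname{Im}\delta,$$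 for nonzero $x\in\lambda(\kappa(D'))$, $u\in\lambda(j_X(\kappa(D)))$, $v\in\lambda(\operatorname{Im}\delta)$, $w\in\lambda(i_Y(\mathfrak c(D')))$, $y\in\lambda(\mathfrak c(D''))$, where $x\wedge u$, $u\wedge v$, $v\wedge w$, $w\wedge y$ denote the images of $x\otimes u$, $u\otimes v$, $v\otimes w$, $w\otimes y$ under the isomorphisms $\wedge_{\kappa(D)}$, $\wedge_{\kappa(D'')}$, $\wedge_{\mathfrak c(D')}$, $\wedge_{\mathfrak c(D)}$ of the four short exact sequences into which the sequence above splits. This does not depend on the choices. **Exact Squares.** Let $$\begin{array}{ccccc} D_{TL}&\to&D_{TM}&\to&D_{TR}\\ \downarrow&&\downarrow&&\downarrow\\ D_{CL}&\to&D_{CM}&\to&D_{CR}\\ \downarrow&&\downarrow&&\downarrow\\ D_{BL}&\to&D_{BM}&\to&D_{BR} \end{array}$$ be a commutative diagram (on domains and on targets) of Fredholm operators between Banach spaces whose three rows and three columns are exact triples. Let $\Psi_T,\Psi_C,\Psi_B$ be the isomorphisms of the top, center and bottom rows and $\Psi_L,\Psi_M,\Psi_R$ those of the left, middle and right columns. Then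 $$\Psi_M\circ(\Psi_T\otimes\Psi_B)\circ(\mathrm{id}\otimes R\otimes\mathrm{id})=\Psi_C\circ(\Psi_L\otimes\Psi_R)$$ as maps $\lambda(D_{TL})\otimes\lambda(D_{BL})\otimes\lambda(D_{TR})\otimes\lambda(D_{BR})\to\lambda(D_{CM})$, where the inner $R$ is the map $\lambda(D_{BL})\otimes\lambda(D_{TR})\to\lambda(D_{TR})\otimes\lambda(D_{BL})$. -/

import Mathlib

open scoped TensorProduct

noncomputable section

namespace DeterminantLine

section TopExterior

variable {V V' V'' : Type*} [AddCommGroup V] [Module ℝ V] [AddCommGroup V'] [Module ℝ V']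
  [AddCommGroup V''] [Module ℝ V'']

/-- The top exterior power `λ(V)` of a finite-dimensional real vector space. -/
abbrev TopExt (V : Type*) [AddCommGroup V] [Module ℝ V] : Type _ :=
  ⋀[ℝ]^(Module.finrank ℝ V) V

/-- The dual line `λ*(V)` of `λ(V)`. -/
abbrev TopExtDual (V : Type*) [AddCommGroup V] [Module ℝ V] : Type _ :=
  Module.Dual ℝ (TopExt V)

theorem finrank_topExt [FiniteDimensional ℝ V] : Module.finrank ℝ (TopExt V) = 1 := by
  rw [exteriorPower.finrank_eq, Nat.choose_self]

theorem finrank_of_ses [FiniteDimensional ℝ V] (i : V' →ₗ[ℝ] V) (j : V →ₗ[ℝ] V'')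
    (hi : Function.Injective i) (hij : Function.Exact i j) (hj : Function.Surjective j) :
    Module.finrank ℝ V' + Module.finrank ℝ V'' = Module.finrank ℝ V := by
  have h := LinearMap.finrank_range_add_finrank_ker j
  rw [LinearMap.range_eq_top.2 hj, finrank_top, hij.linearMap_ker_eq,
    LinearMap.finrank_range_of_inj hi] at h
  omega

/-- A linear right inverse of a surjective linear map. -/
def section_ (j : V →ₗ[ℝ] V'') (hj : Function.Surjective j) : V'' →ₗ[ℝ] V :=
  (j.exists_rightInverse_of_surjective (LinearMap.range_eq_top.2 hj)).choose

theorem section_spec (j : V →ₗ[ℝ] V'') (hj : Function.Surjective j) (x : V'') :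
    j (section_ j hj x) = x :=
  DFunLike.congr_fun
    (j.exists_rightInverse_of_surjective (LinearMap.range_eq_top.2 hj)).choose_spec x

/-- The bilinear map `(x', x'') ↦ i(x') ∧ s(x'')`, for `s` a linear right inverse of `j`. -/
def wedgeBilin [FiniteDimensional ℝ V] (i : V' →ₗ[ℝ] V) (j : V →ₗ[ℝ] V'')
    (hi : Function.Injective i) (hij : Function.Exact i j) (hj : Function.Surjective j) :
    TopExt V' →ₗ[ℝ] TopExt V'' →ₗ[ℝ] TopExt V :=
  LinearMap.mk₂ ℝ
    (fun x' x'' ↦ ⟨(exteriorPower.map _ i x' : ExteriorAlgebra ℝ V) *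
        (exteriorPower.map _ (section_ j hj) x'' : ExteriorAlgebra ℝ V), by
      rw [← finrank_of_ses i j hi hij hj]
      exact SetLike.mul_mem_graded (SetLike.coe_mem _) (SetLike.coe_mem _)⟩)
    (fun a b c ↦ by ext; simp [add_mul])
    (fun r a c ↦ by ext; simp)
    (fun a b c ↦ by ext; simp [mul_add])
    (fun r a c ↦ by ext; simp)

theorem wedgeBilin_ιMulti [FiniteDimensional ℝ V] (i : V' →ₗ[ℝ] V) (j : V →ₗ[ℝ] V'')
    (hi : Function.Injective i) (hij : Function.Exact i j) (hj : Function.Surjective j)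
    (v' : Fin (Module.finrank ℝ V') → V') (v'' : Fin (Module.finrank ℝ V'') → V'') :
    (wedgeBilin i j hi hij hj (exteriorPower.ιMulti ℝ _ v') (exteriorPower.ιMulti ℝ _ v'') :
      ExteriorAlgebra ℝ V) =
    ExteriorAlgebra.ιMulti ℝ _ (Fin.append (i ∘ v') (section_ j hj ∘ v'')) := by
  simp only [wedgeBilin, LinearMap.mk₂_apply, exteriorPower.map_apply_ιMulti,
    exteriorPower.ιMulti_apply_coe, ExteriorAlgebra.ιMulti_apply]
  rw [← List.prod_append, ← List.ofFn_fin_append]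
  congr 2
  funext k
  refine Fin.addCases (fun a ↦ ?_) (fun a ↦ ?_) k <;> simp

theorem wedgeBilin_ne_zero [FiniteDimensional ℝ V] (i : V' →ₗ[ℝ] V) (j : V →ₗ[ℝ] V'')
    (hi : Function.Injective i) (hij : Function.Exact i j) (hj : Function.Surjective j)
    (v' : Module.Basis (Fin (Module.finrank ℝ V')) ℝ V')
    (v'' : Module.Basis (Fin (Module.finrank ℝ V'')) ℝ V'') :
    wedgeBilin i j hi hij hj (exteriorPower.ιMulti ℝ _ v') (exteriorPower.ιMulti ℝ _ v'') ≠ 0 := by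
  intro h0
  have h1 := wedgeBilin_ιMulti i j hi hij hj v' v''
  rw [h0] at h1
  have hli : LinearIndependent ℝ (Fin.append (i ∘ v') (section_ j hj ∘ v'')) := by
    rw [Fintype.linearIndependent_iff]
    intro c hc
    rw [Fin.sum_univ_add] at hc
    simp only [Fin.append_left, Fin.append_right, Function.comp_apply] at hc
    have hc2 := congrArg j hc
    simp only [map_add, map_sum, map_smul, hij.apply_apply_eq_zero, section_spec, smul_zero,
      Finset.sum_const_zero, zero_add, map_zero] at hc2
    have hr := Fintype.linearIndependent_iff.1 v''.linearIndependent _ hc2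
    simp only [hr, zero_smul, Finset.sum_const_zero, add_zero] at hc
    have hc3 : i (∑ k, c (Fin.castAdd _ k) • v' k) = i 0 := by simpa using hc
    have hl := Fintype.linearIndependent_iff.1 v'.linearIndependent _ (hi hc3)
    exact fun k ↦ Fin.addCases hl hr k
  let b := basisOfLinearIndependentOfCardEqFinrank' _ hli
    (by rw [Fintype.card_fin, finrank_of_ses i j hi hij hj])
  have hb : (b : Fin _ → V) = Fin.append (i ∘ v') (section_ j hj ∘ v'') :=
    coe_basisOfLinearIndependentOfCardEqFinrank' _ _ _
  have h2 := congrArg (ExteriorAlgebra.liftAlternating (R := ℝ)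
    (Function.update (fun _ ↦ 0) _ b.det)) h1
  rw [← hb, ExteriorAlgebra.liftAlternating_apply_ιMulti, Function.update_self, b.det_self] at h2
  simp at h2

theorem wedge_bijective [FiniteDimensional ℝ V] (i : V' →ₗ[ℝ] V) (j : V →ₗ[ℝ] V'')
    (hi : Function.Injective i) (hij : Function.Exact i j) (hj : Function.Surjective j) :
    Function.Bijective (TensorProduct.lift (wedgeBilin i j hi hij hj)) := by
  have : FiniteDimensional ℝ V' := FiniteDimensional.of_injective i hi
  have : FiniteDimensional ℝ V'' := Module.Finite.of_surjective j hj
  have hfr : Module.finrank ℝ (TopExt V' ⊗[ℝ] TopExt V'') = Module.finrank ℝ (TopExt V) := by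
    rw [Module.finrank_tensorProduct, finrank_topExt, finrank_topExt, finrank_topExt]
  have hs : Function.Surjective (TensorProduct.lift (wedgeBilin i j hi hij hj)) := by
    intro y
    obtain ⟨c, hc⟩ := (finrank_eq_one_iff_of_nonzero' _ (wedgeBilin_ne_zero i j hi hij hj
      (Module.finBasis ℝ V') (Module.finBasis ℝ V''))).1 finrank_topExt y
    exact ⟨c • (exteriorPower.ιMulti ℝ _ (Module.finBasis ℝ V') ⊗ₜ
      exteriorPower.ιMulti ℝ _ (Module.finBasis ℝ V'')), by rw [map_smul, TensorProduct.lift.tmul, hc]⟩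
  exact ⟨(LinearMap.injective_iff_surjective_of_finrank_eq_finrank
    (V := TopExt V' ⊗[ℝ] TopExt V'') (V₂ := TopExt V) hfr).2 hs, hs⟩

/-- The isomorphism `∧_V : λ(V') ⊗ λ(V'') ≃ λ(V)` of a short exact sequence
`0 → V' → V → V'' → 0`; it sends
`(v'₁ ∧ ⋯ ∧ v'ₖ) ⊗ (j v₁ ∧ ⋯ ∧ j vₗ)` to `i v'₁ ∧ ⋯ ∧ i v'ₖ ∧ v₁ ∧ ⋯ ∧ vₗ`. -/
def wedge [FiniteDimensional ℝ V] (i : V' →ₗ[ℝ] V) (j : V →ₗ[ℝ] V'')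
    (hi : Function.Injective i) (hij : Function.Exact i j) (hj : Function.Surjective j) :
    TopExt V' ⊗[ℝ] TopExt V'' ≃ₗ[ℝ] TopExt V :=
  LinearEquiv.ofBijective (TensorProduct.lift (wedgeBilin i j hi hij hj))
    (wedge_bijective i j hi hij hj)

theorem eval_bijective {L : Type*} [AddCommGroup L] [Module ℝ L]
    (hL : Module.finrank ℝ L = 1) : Function.Bijective (contractRight ℝ L) := by
  have : FiniteDimensional ℝ L := FiniteDimensional.of_finrank_pos (by omega)
  have hfr : Module.finrank ℝ (L ⊗[ℝ] Module.Dual ℝ L) = Module.finrank ℝ ℝ := by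
    rw [Module.finrank_tensorProduct, Subspace.dual_finrank_eq, hL, Module.finrank_self]
  have hs : Function.Surjective (contractRight ℝ L) := by
    intro r
    have : Nontrivial L := Module.nontrivial_of_finrank_pos (R := ℝ) (by omega)
    obtain ⟨x, hx⟩ := exists_ne (0 : L)
    obtain ⟨f, hf⟩ : ∃ f : Module.Dual ℝ L, f x ≠ 0 := by
      by_contra! h
      exact hx ((Module.forall_dual_apply_eq_zero_iff ℝ x).1 h)
    exact ⟨(r / f x) • (x ⊗ₜ f), by simp [hf]⟩
  refine ⟨?_, hs⟩
  rwa [LinearMap.injective_iff_surjective_of_finrank_eq_finrank hfr]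

/-- The evaluation isomorphism `L ⊗ L* ≃ ℝ` of a line. -/
def evalEquiv (L : Type*) [AddCommGroup L] [Module ℝ L] (hL : Module.finrank ℝ L = 1) :
    L ⊗[ℝ] Module.Dual ℝ L ≃ₗ[ℝ] ℝ :=
  LinearEquiv.ofBijective (contractRight ℝ L) (eval_bijective hL)

end TopExterior

section Fredholm

/-- Fredholm operators between real Banach spaces. -/
structure FredholmOp (X Y : Type*) [NormedAddCommGroup X] [NormedSpace ℝ X] [CompleteSpace X]
    [NormedAddCommGroup Y] [NormedSpace ℝ Y] [CompleteSpace Y] where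
  /-- The underlying bounded operator. -/
  op : X →L[ℝ] Y
  isFredholm : op.IsFredholm

variable {X Y X' Y' X'' Y'' : Type*}
  [NormedAddCommGroup X] [NormedSpace ℝ X] [CompleteSpace X]
  [NormedAddCommGroup Y] [NormedSpace ℝ Y] [CompleteSpace Y]
  [NormedAddCommGroup X'] [NormedSpace ℝ X'] [CompleteSpace X']
  [NormedAddCommGroup Y'] [NormedSpace ℝ Y'] [CompleteSpace Y']
  [NormedAddCommGroup X''] [NormedSpace ℝ X''] [CompleteSpace X'']
  [NormedAddCommGroup Y''] [NormedSpace ℝ Y''] [CompleteSpace Y'']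

namespace FredholmOp

/-- The underlying linear map. -/
abbrev lin (D : FredholmOp X Y) : X →ₗ[ℝ] Y := D.op

/-- The kernel `κ(D)`. -/
abbrev Ker (D : FredholmOp X Y) : Type _ := LinearMap.ker D.lin

/-- The cokernel `𝔠(D) = Y / Im D`. -/
abbrev Coker (D : FredholmOp X Y) : Type _ := Y ⧸ LinearMap.range D.lin

instance finite_ker (D : FredholmOp X Y) : FiniteDimensional ℝ D.Ker := D.isFredholm.finite_ker

instance finite_coker (D : FredholmOp X Y) : FiniteDimensional ℝ D.Coker :=
  D.isFredholm.finite_coker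

/-- The Fredholm index. -/
def index (D : FredholmOp X Y) : ℤ :=
  (Module.finrank ℝ D.Ker : ℤ) - (Module.finrank ℝ D.Coker : ℤ)

/-- The determinant line `λ(D) = λ(κ(D)) ⊗ λ*(𝔠(D))`; its degree is the parity of `D.index`. -/
abbrev DetLine (D : FredholmOp X Y) : Type _ := TopExt D.Ker ⊗[ℝ] TopExtDual D.Coker

end FredholmOp

/-- The map `v ↦ (-1)ᵏ v`. -/
def signEquiv (L : Type*) [AddCommMonoid L] [Module ℝ L] (k : ℤ) : L ≃ₗ[ℝ] L :=
  LinearEquiv.smulOfUnit ((-1 : ℝˣ) ^ k)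

/-- The graded interchange `R : λ(D₁) ⊗ λ(D₂) ≃ λ(D₂) ⊗ λ(D₁)`,
`v₁ ⊗ v₂ ↦ (-1)^(deg λ(D₁) deg λ(D₂)) v₂ ⊗ v₁`. -/
def gradedSwap (D₁ : FredholmOp X' Y') (D₂ : FredholmOp X'' Y'') :
    D₁.DetLine ⊗[ℝ] D₂.DetLine ≃ₗ[ℝ] D₂.DetLine ⊗[ℝ] D₁.DetLine :=
  TensorProduct.comm ℝ D₁.DetLine D₂.DetLine ≪≫ₗ signEquiv _ (D₁.index * D₂.index)

/-- The map `id ⊗ R ⊗ id`, interchanging the two inner factors by `R`. -/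
def middleSwap {X₁ Y₁ X₂ Y₂ X₃ Y₃ X₄ Y₄ : Type*}
    [NormedAddCommGroup X₁] [NormedSpace ℝ X₁] [CompleteSpace X₁]
    [NormedAddCommGroup Y₁] [NormedSpace ℝ Y₁] [CompleteSpace Y₁]
    [NormedAddCommGroup X₂] [NormedSpace ℝ X₂] [CompleteSpace X₂]
    [NormedAddCommGroup Y₂] [NormedSpace ℝ Y₂] [CompleteSpace Y₂]
    [NormedAddCommGroup X₃] [NormedSpace ℝ X₃] [CompleteSpace X₃]
    [NormedAddCommGroup Y₃] [NormedSpace ℝ Y₃] [CompleteSpace Y₃]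
    [NormedAddCommGroup X₄] [NormedSpace ℝ X₄] [CompleteSpace X₄]
    [NormedAddCommGroup Y₄] [NormedSpace ℝ Y₄] [CompleteSpace Y₄]
    (D₁ : FredholmOp X₁ Y₁) (D₂ : FredholmOp X₂ Y₂) (D₃ : FredholmOp X₃ Y₃)
    (D₄ : FredholmOp X₄ Y₄) :
    (D₁.DetLine ⊗[ℝ] D₂.DetLine) ⊗[ℝ] (D₃.DetLine ⊗[ℝ] D₄.DetLine) ≃ₗ[ℝ]
      (D₁.DetLine ⊗[ℝ] D₃.DetLine) ⊗[ℝ] (D₂.DetLine ⊗[ℝ] D₄.DetLine) :=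
  TensorProduct.assoc ℝ D₁.DetLine D₂.DetLine (D₃.DetLine ⊗[ℝ] D₄.DetLine) ≪≫ₗ
    TensorProduct.congr (LinearEquiv.refl ℝ D₁.DetLine)
      ((TensorProduct.assoc ℝ D₂.DetLine D₃.DetLine D₄.DetLine).symm ≪≫ₗ
        TensorProduct.congr (gradedSwap D₂ D₃) (LinearEquiv.refl ℝ D₄.DetLine) ≪≫ₗ
        TensorProduct.assoc ℝ D₃.DetLine D₂.DetLine D₄.DetLine) ≪≫ₗ
    (TensorProduct.assoc ℝ D₁.DetLine D₃.DetLine (D₂.DetLine ⊗[ℝ] D₄.DetLine)).symm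

/-- An exact triple `0 → D' → D → D'' → 0` of Fredholm operators: a commutative diagram
with rows `0 → X' → X → X'' → 0` and `0 → Y' → Y → Y'' → 0` that are exact. -/
structure ExactTriple (D' : FredholmOp X' Y') (D : FredholmOp X Y) (D'' : FredholmOp X'' Y'') where
  iX : X' →L[ℝ] X
  jX : X →L[ℝ] X''
  iY : Y' →L[ℝ] Y
  jY : Y →L[ℝ] Y''
  iX_injective : Function.Injective iX
  exactX : Function.Exact iX jX
  jX_surjective : Function.Surjective jX
  iY_injective : Function.Injective iY
  exactY : Function.Exact iY jY
  jY_surjective : Function.Surjective jY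
  comm_i : D.op ∘L iX = iY ∘L D'.op
  comm_j : D''.op ∘L jX = jY ∘L D.op

namespace ExactTriple

variable {D' : FredholmOp X' Y'} {D : FredholmOp X Y} {D'' : FredholmOp X'' Y''}
  (t : ExactTriple D' D D'')

theorem comm_i_apply (x : X') : D.op (t.iX x) = t.iY (D'.op x) := DFunLike.congr_fun t.comm_i x

theorem comm_j_apply (x : X) : D''.op (t.jX x) = t.jY (D.op x) := DFunLike.congr_fun t.comm_j x

/-- `κ(D') → κ(D)` induced by `iX`. -/
def iKer : D'.Ker →ₗ[ℝ] D.Ker :=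
  (t.iX : X' →ₗ[ℝ] X).restrict fun x hx ↦ by
    have hx' : D'.op x = 0 := hx
    change D.op (t.iX x) = 0
    rw [t.comm_i_apply, hx', map_zero]

/-- `κ(D) → κ(D'')` induced by `jX`. -/
def jKer : D.Ker →ₗ[ℝ] D''.Ker :=
  (t.jX : X →ₗ[ℝ] X'').restrict fun x hx ↦ by
    have hx' : D.op x = 0 := hx
    change D''.op (t.jX x) = 0
    rw [t.comm_j_apply, hx', map_zero]

/-- `𝔠(D') → 𝔠(D)` induced by `iY`. -/
def iCoker : D'.Coker →ₗ[ℝ] D.Coker :=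
  Submodule.mapQ _ _ (t.iY : Y' →ₗ[ℝ] Y) <| by
    rintro _ ⟨x, rfl⟩
    exact ⟨t.iX x, t.comm_i_apply x⟩

/-- `𝔠(D) → 𝔠(D'')` induced by `jY`. -/
def jCoker : D.Coker →ₗ[ℝ] D''.Coker :=
  Submodule.mapQ _ _ (t.jY : Y →ₗ[ℝ] Y'') <| by
    rintro _ ⟨x, rfl⟩
    exact ⟨t.jX x, t.comm_j_apply x⟩

/-- The connecting homomorphism `δ : κ(D'') → 𝔠(D')` of the Snake Lemma:
`δ(x'') = y' + Im D'` whenever `x'' = jX x` and `iY y' = D x`. -/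
def delta : D''.Ker →ₗ[ℝ] D'.Coker :=
  SnakeLemma.δ' D'.lin D.lin D''.lin (t.iX : X' →ₗ[ℝ] X) (t.jX : X →ₗ[ℝ] X'') t.exactX
    (t.iY : Y' →ₗ[ℝ] Y) (t.jY : Y →ₗ[ℝ] Y'') t.exactY
    (LinearMap.ext fun x ↦ (t.comm_i_apply x).symm) (LinearMap.ext fun x ↦ (t.comm_j_apply x).symm)
    (LinearMap.ker D''.lin).subtype (LinearMap.exact_subtype_ker_map _)
    (LinearMap.range D'.lin).mkQ (LinearMap.exact_map_mkQ_range _)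
    t.jX_surjective t.iY_injective

theorem iKer_injective : Function.Injective t.iKer := fun _ _ h ↦
  Subtype.ext (t.iX_injective (congrArg Subtype.val h))

theorem exact_ker : Function.Exact t.iKer t.jKer := by
  intro x
  constructor
  · intro h
    have h' : t.jX x = 0 := congrArg Subtype.val h
    obtain ⟨a, ha⟩ := (t.exactX _).1 h'
    have hx : D.op x = 0 := x.2
    refine ⟨⟨a, t.iY_injective ?_⟩, Subtype.ext ha⟩
    change t.iY (D'.op a) = t.iY 0
    rw [← t.comm_i_apply, ha, hx, map_zero]
  · rintro ⟨a, rfl⟩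
    exact Subtype.ext (t.exactX.apply_apply_eq_zero a)

theorem exact_jKer_delta : Function.Exact t.jKer t.delta :=
  SnakeLemma.exact_δ'_right _ _ _ _ _ _ _ _ _ _ _ (LinearMap.ker D.lin).subtype
    (LinearMap.exact_subtype_ker_map _) _ _ _ _ _ _ t.jKer rfl (Submodule.subtype_injective _)

theorem exact_delta_iCoker : Function.Exact t.delta t.iCoker :=
  SnakeLemma.exact_δ'_left _ _ _ _ _ _ _ _ _ _ _ _ _ _ _ (LinearMap.range D.lin).mkQ
    (LinearMap.exact_map_mkQ_range _) _ _ t.iCoker rfl (Submodule.mkQ_surjective _)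

theorem exact_coker : Function.Exact t.iCoker t.jCoker := by
  intro y
  obtain ⟨y, rfl⟩ := Submodule.mkQ_surjective _ y
  constructor
  · intro h
    obtain ⟨x'', hx''⟩ := (Submodule.Quotient.mk_eq_zero _).1 h
    obtain ⟨x, rfl⟩ := t.jX_surjective x''
    have h1 : t.jY (y - D.op x) = 0 := by
      rw [map_sub, ← t.comm_j_apply, sub_eq_zero]
      exact hx''.symm
    obtain ⟨y', hy'⟩ := (t.exactY _).1 h1
    refine ⟨Submodule.Quotient.mk y', (Submodule.Quotient.eq _).2 ⟨-x, ?_⟩⟩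
    change D.op (-x) = t.iY y' - y
    rw [hy', map_neg]
    abel
  · rintro ⟨y', h⟩
    obtain ⟨y', rfl⟩ := Submodule.mkQ_surjective _ y'
    rw [← h]
    change Submodule.Quotient.mk (t.jY (t.iY y')) = _
    rw [t.exactY.apply_apply_eq_zero]
    rfl

theorem jCoker_surjective : Function.Surjective t.jCoker := by
  intro y
  obtain ⟨y, rfl⟩ := Submodule.mkQ_surjective _ y
  obtain ⟨z, rfl⟩ := t.jY_surjective y
  exact ⟨Submodule.Quotient.mk z, rfl⟩

/-- `λ(κ(D')) ⊗ λ(Im jX) ≃ λ(κ(D))`. -/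
def wedgeKer : TopExt D'.Ker ⊗[ℝ] TopExt (LinearMap.range t.jKer) ≃ₗ[ℝ] TopExt D.Ker :=
  wedge t.iKer t.jKer.rangeRestrict t.iKer_injective
    (by
      rw [LinearMap.exact_iff, LinearMap.ker_rangeRestrict]
      exact t.exact_ker.linearMap_ker_eq)
    t.jKer.surjective_rangeRestrict

/-- `λ(Im jX) ⊗ λ(Im δ) ≃ λ(κ(D''))`. -/
def wedgeKer'' :
    TopExt (LinearMap.range t.jKer) ⊗[ℝ] TopExt (LinearMap.range t.delta) ≃ₗ[ℝ]
      TopExt D''.Ker :=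
  wedge (LinearMap.range t.jKer).subtype t.delta.rangeRestrict (Submodule.subtype_injective _)
    (by
      rw [LinearMap.exact_iff, LinearMap.ker_rangeRestrict, Submodule.range_subtype]
      exact t.exact_jKer_delta.linearMap_ker_eq)
    t.delta.surjective_rangeRestrict

/-- `λ(Im δ) ⊗ λ(Im iY) ≃ λ(𝔠(D'))`. -/
def wedgeCoker' :
    TopExt (LinearMap.range t.delta) ⊗[ℝ] TopExt (LinearMap.range t.iCoker) ≃ₗ[ℝ]
      TopExt D'.Coker :=
  wedge (LinearMap.range t.delta).subtype t.iCoker.rangeRestrict (Submodule.subtype_injective _)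
    (by
      rw [LinearMap.exact_iff, LinearMap.ker_rangeRestrict, Submodule.range_subtype]
      exact t.exact_delta_iCoker.linearMap_ker_eq)
    t.iCoker.surjective_rangeRestrict

/-- `λ(Im iY) ⊗ λ(𝔠(D'')) ≃ λ(𝔠(D))`. -/
def wedgeCoker : TopExt (LinearMap.range t.iCoker) ⊗[ℝ] TopExt D''.Coker ≃ₗ[ℝ] TopExt D.Coker :=
  wedge (LinearMap.range t.iCoker).subtype t.jCoker (Submodule.subtype_injective _)
    (by
      rw [LinearMap.exact_iff, Submodule.range_subtype]
      exact t.exact_coker.linearMap_ker_eq)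
    t.jCoker_surjective

/-- The sign exponent `ε = (ind D'') dim 𝔠(D') + dim 𝔠(D) dim (Im δ)`. -/
def eps : ℤ :=
  D''.index * (Module.finrank ℝ D'.Coker : ℤ) +
    (Module.finrank ℝ D.Coker : ℤ) * (Module.finrank ℝ (LinearMap.range t.delta) : ℤ)

/-- The part of `Ψ` on the kernel lines:
`x ⊗ (u ∧ v) ↦ (x ∧ u) ⊗ v`, where `u ∈ λ(Im jX)` and `v ∈ λ(Im δ)`. -/
def psiKer : TopExt D'.Ker ⊗[ℝ] TopExt D''.Ker ≃ₗ[ℝ]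
    TopExt D.Ker ⊗[ℝ] TopExt (LinearMap.range t.delta) :=
  TensorProduct.congr (LinearEquiv.refl ℝ _) t.wedgeKer''.symm ≪≫ₗ
    (TensorProduct.assoc ℝ _ _ _).symm ≪≫ₗ
    TensorProduct.congr t.wedgeKer (LinearEquiv.refl ℝ _)

/-- The part of `Ψ` on the dual cokernel lines:
`(v ∧ w)* ⊗ y* ↦ v* ⊗ (w ∧ y)*`, where `v ∈ λ(Im δ)` and `w ∈ λ(Im iY)`. -/
def psiCoker : TopExtDual D'.Coker ⊗[ℝ] TopExtDual D''.Coker ≃ₗ[ℝ]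
    TopExtDual (LinearMap.range t.delta) ⊗[ℝ] TopExtDual D.Coker :=
  TensorProduct.congr
      (t.wedgeCoker'.dualMap ≪≫ₗ (TensorProduct.dualDistribEquiv ℝ _ _).symm)
      (LinearEquiv.refl ℝ _) ≪≫ₗ
    TensorProduct.assoc ℝ _ _ _ ≪≫ₗ
    TensorProduct.congr (LinearEquiv.refl ℝ _)
      (TensorProduct.dualDistribEquiv ℝ _ _ ≪≫ₗ t.wedgeCoker.symm.dualMap)

/-- The isomorphism `Ψ_t : λ(D') ⊗ λ(D'') ≃ λ(D)` of an exact triple,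
`x ⊗ (v ∧ w)* ⊗ (u ∧ v) ⊗ y* ↦ (-1)^ε (x ∧ u) ⊗ (w ∧ y)*`
for nonzero `x ∈ λ(κ(D'))`, `u ∈ λ(Im jX)`, `v ∈ λ(Im δ)`, `w ∈ λ(Im iY)`, `y ∈ λ(𝔠(D''))`. -/
def psi : D'.DetLine ⊗[ℝ] D''.DetLine ≃ₗ[ℝ] D.DetLine :=
  TensorProduct.tensorTensorTensorComm ℝ _ _ _ _ ≪≫ₗ
    TensorProduct.congr t.psiKer t.psiCoker ≪≫ₗ
    TensorProduct.assoc ℝ _ _ _ ≪≫ₗ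
    TensorProduct.congr (LinearEquiv.refl ℝ _)
      ((TensorProduct.assoc ℝ _ _ _).symm ≪≫ₗ
        TensorProduct.congr (evalEquiv _ finrank_topExt) (LinearEquiv.refl ℝ _) ≪≫ₗ
        TensorProduct.lid ℝ _) ≪≫ₗ
    signEquiv _ t.eps

end ExactTriple

end Fredholm

end DeterminantLine

end

open DeterminantLine

/-! The square is reduced to finite-dimensional linear algebra. Let `E ⊆ Y` be a finite-dimensional
subspace with `E + Im D = Y`, and put `K = D⁻¹(E)`. The restriction `d : K → E` has the same kernel
and cokernel as `D`, so splitting off `Im d`, which occurs in `K` and dually in `E`, identifies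
`λ(K) ⊗ λ*(E)` with `λ(D)`. This is `FiniteModel.detEquiv`, normalised by a sign.

If the subspaces chosen for the three operators of a triple form a short exact sequence, so do their
preimages. Under the identifications `Ψ` then becomes the plain wedge product on the lines `λ(K)`
and `λ*(E)`, up to the sign `(-1)^(ind D'' · dim E')` (`TripleModel.psi_detEquiv`). The connecting
map `δ` has disappeared from the formula.

For nine compatible models, comparing the two ways around the square amounts to comparing `α ∧ γ ∧ β
∧ ζ` with `α ∧ β ∧ γ ∧ ζ`, once for the `K`s and once for the dual `E`s (`wedge_wedge`,
`wedgeDual_wedgeDual`). The two resulting signs, the sign of `R` and the signs of the six `Ψ`s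
cancel by a parity count (`even_square_sign_sub`).

Compatible models exist by `exists_adapted_square`: spanning subspaces are chosen at the four
corners only, and linear sections of the surjections carry them to the other five targets. -/

noncomputable section

namespace DeterminantLine

/-! ### Wedge products of lists of vectors and the isomorphism `wedge`. -/

section WedgeList

variable {V V' V'' : Type*} [AddCommGroup V] [Module ℝ V] [AddCommGroup V'] [Module ℝ V']
  [AddCommGroup V''] [Module ℝ V'']

/-- The wedge product of a list of vectors, in the exterior algebra. -/
def wedgeList (l : List V) : ExteriorAlgebra ℝ V := (l.map (ExteriorAlgebra.ι ℝ)).prod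

@[simp]
theorem wedgeList_nil : wedgeList ([] : List V) = 1 := rfl

@[simp]
theorem wedgeList_cons (a : V) (l : List V) :
    wedgeList (a :: l) = ExteriorAlgebra.ι ℝ a * wedgeList l := by
  simp [wedgeList]

@[simp]
theorem wedgeList_append (l₁ l₂ : List V) :
    wedgeList (l₁ ++ l₂) = wedgeList l₁ * wedgeList l₂ := by
  simp [wedgeList]

theorem wedgeList_mem (l : List V) : wedgeList l ∈ ⋀[ℝ]^l.length V := by
  induction l with
  | nil => exact Submodule.one_le.1 (by simp)
  | cons a l ih =>
    rw [wedgeList_cons, List.length_cons]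
    change _ ∈ LinearMap.range (ExteriorAlgebra.ι ℝ) ^ (l.length + 1)
    rw [pow_succ']
    exact Submodule.mul_mem_mul (LinearMap.mem_range_self _ a) ih

theorem map_wedgeList (f : V →ₗ[ℝ] V') (l : List V) :
    ExteriorAlgebra.map f (wedgeList l) = wedgeList (l.map f) := by
  induction l with
  | nil => simp
  | cons a l ih => simp [ih]

theorem coe_exteriorPower_map (f : V →ₗ[ℝ] V') (n : ℕ) (x : ⋀[ℝ]^n V) :
    (exteriorPower.map n f x : ExteriorAlgebra ℝ V') = ExteriorAlgebra.map f x := by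
  have h : (⋀[ℝ]^n V').subtype ∘ₗ exteriorPower.map n f =
      (ExteriorAlgebra.map f).toLinearMap ∘ₗ (⋀[ℝ]^n V).subtype := by
    ext v
    simp [ExteriorAlgebra.map_apply_ιMulti]
  exact DFunLike.congr_fun h x

theorem ι_mul_wedgeList (a : V) (l : List V) :
    ExteriorAlgebra.ι ℝ a * wedgeList l =
      (-1 : ℝ) ^ l.length • (wedgeList l * ExteriorAlgebra.ι ℝ a) := by
  induction l with
  | nil => simp
  | cons b l ih =>
    rw [wedgeList_cons, ← mul_assoc, eq_neg_of_add_eq_zero_left (ExteriorAlgebra.ι_add_mul_swap a b),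
      neg_mul, mul_assoc, ih, List.length_cons, pow_succ, mul_neg_one, neg_smul, mul_smul_comm,
      mul_assoc]

theorem wedgeList_mul_comm (l₁ l₂ : List V) :
    wedgeList l₁ * wedgeList l₂ =
      (-1 : ℝ) ^ (l₁.length * l₂.length) • (wedgeList l₂ * wedgeList l₁) := by
  induction l₁ with
  | nil => simp
  | cons a l ih =>
    rw [wedgeList_cons, mul_assoc, ih, mul_smul_comm, ← mul_assoc, ι_mul_wedgeList, smul_mul_assoc,
      smul_smul, mul_assoc, List.length_cons, add_mul, one_mul, pow_add]

theorem wedgeList_eq_zero_of_finrank_lt [FiniteDimensional ℝ V] (l : List V)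
    (hl : Module.finrank ℝ V < l.length) : wedgeList l = 0 := by
  have h : Module.finrank ℝ (⋀[ℝ]^l.length V) = 0 := by
    rw [exteriorPower.finrank_eq, Nat.choose_eq_zero_of_lt hl]
  have := Module.finrank_zero_iff.1 h
  exact congrArg Subtype.val (Subsingleton.elim (⟨_, wedgeList_mem l⟩ : ⋀[ℝ]^l.length V) 0)

/-- Modulo the span of `l'`, only the images of the remaining vectors matter. -/
theorem wedgeList_map_mul_congr [FiniteDimensional ℝ V'] (i : V' →ₗ[ℝ] V) (j : V →ₗ[ℝ] V'')
    (hij : Function.Exact i j) (l' : List V') (hl' : l'.length = Module.finrank ℝ V')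
    (l₁ l₂ : List V) (h : l₁.map j = l₂.map j) :
    wedgeList (l'.map i) * wedgeList l₁ = wedgeList (l'.map i) * wedgeList l₂ := by
  induction l₁ generalizing l₂ with
  | nil =>
    obtain rfl : l₂ = [] := by simpa using h.symm
    rfl
  | cons a l ih =>
    obtain _ | ⟨b, l₂⟩ := l₂
    · simp at h
    simp only [List.map_cons, List.cons.injEq] at h
    -- `a - b` comes from a vector `c` of `V'`. Adding `c` to `l'` gives `dim V' + 1` vectors of
    -- `V'`, whose wedge vanishes.
    obtain ⟨c, hc⟩ := (hij (a - b)).1 (by rw [map_sub, h.1, sub_self])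
    have h0 : wedgeList (l'.map i) * ExteriorAlgebra.ι ℝ (a - b) = 0 := by
      have h1 : wedgeList (l' ++ [c]) = 0 :=
        wedgeList_eq_zero_of_finrank_lt _ (by simp [hl'])
      have h2 := congrArg (ExteriorAlgebra.map i) h1
      rw [map_wedgeList, map_zero] at h2
      simpa [hc] using h2
    have h3 : wedgeList (l'.map i) * ExteriorAlgebra.ι ℝ a =
        wedgeList (l'.map i) * ExteriorAlgebra.ι ℝ b := by
      rwa [map_sub, mul_sub, sub_eq_zero] at h0
    -- Moving `b` to the front makes the block of `l'` adjacent to the tail, as the induction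
    -- hypothesis requires. Both sides acquire the same sign.
    have h4 : ∀ m : ExteriorAlgebra ℝ V, wedgeList (l'.map i) * ExteriorAlgebra.ι ℝ b * m =
        (-1 : ℝ) ^ (l'.map i).length • (ExteriorAlgebra.ι ℝ b * (wedgeList (l'.map i) * m)) := by
      intro m
      rw [← mul_assoc (ExteriorAlgebra.ι ℝ b), ι_mul_wedgeList, smul_mul_assoc, smul_smul,
        ← mul_pow, neg_one_mul, neg_neg, one_pow, one_smul]
    rw [wedgeList_cons, wedgeList_cons, ← mul_assoc, ← mul_assoc, h3, h4, h4, ih _ h.2]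

/-- The wedge product of a list of `dim V` vectors, in `λ(V)`; zero for other lists. -/
def topWedge (l : List V) : TopExt V :=
  if h : l.length = Module.finrank ℝ V then ⟨wedgeList l, h ▸ wedgeList_mem l⟩ else 0

theorem coe_topWedge (l : List V) (h : l.length = Module.finrank ℝ V) :
    (topWedge l : ExteriorAlgebra ℝ V) = wedgeList l := by
  rw [topWedge, dif_pos h]

/-- Thanks to the default value zero, `topWedge l ≠ 0` serves as the condition "`l` is a basis" and
carries the length of `l` with it. -/
theorem length_of_topWedge_ne_zero {l : List V} (h : topWedge l ≠ 0) :
    l.length = Module.finrank ℝ V := by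
  by_contra h'
  exact h (dif_neg h')

theorem topWedge_swap (l₁ l₂ l₃ l₄ : List V) :
    topWedge (l₁ ++ (l₂ ++ (l₃ ++ l₄))) =
      (-1 : ℝ) ^ (l₂.length * l₃.length) • topWedge (l₁ ++ (l₃ ++ (l₂ ++ l₄))) := by
  by_cases h : (l₁ ++ (l₂ ++ (l₃ ++ l₄))).length = Module.finrank ℝ V
  · have h' : (l₁ ++ (l₃ ++ (l₂ ++ l₄))).length = Module.finrank ℝ V := by
      rw [← h]; simp; omega
    ext
    rw [Submodule.coe_smul, coe_topWedge _ h, coe_topWedge _ h']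
    simp only [wedgeList_append]
    rw [← mul_assoc (wedgeList l₂), wedgeList_mul_comm l₂, smul_mul_assoc, mul_smul_comm, mul_assoc]
  · have h' : ¬ (l₁ ++ (l₃ ++ (l₂ ++ l₄))).length = Module.finrank ℝ V := by
      intro h''; apply h; rw [← h'']; simp; omega
    rw [topWedge, topWedge, dif_neg h, dif_neg h', smul_zero]

/-- `wedge` is built from a chosen section of `j`. Any other lifts differ from the chosen ones by
vectors of `i(V')`, which the full wedge of `V'` absorbs, so arbitrary lifts may be used. All later
computations go through this formula. -/
theorem wedge_topWedge [FiniteDimensional ℝ V] (i : V' →ₗ[ℝ] V) (j : V →ₗ[ℝ] V'')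
    (hi : Function.Injective i) (hij : Function.Exact i j) (hj : Function.Surjective j)
    (l' : List V') (l : List V) (hl' : l'.length = Module.finrank ℝ V')
    (hl : l.length = Module.finrank ℝ V'') :
    wedge i j hi hij hj (topWedge l' ⊗ₜ topWedge (l.map j)) = topWedge (l'.map i ++ l) := by
  have : FiniteDimensional ℝ V' := FiniteDimensional.of_injective i hi
  ext
  rw [coe_topWedge _ (by simp [← finrank_of_ses i j hi hij hj, hl, hl'])]
  simp only [wedge, LinearEquiv.ofBijective_apply, TensorProduct.lift.tmul, wedgeBilin,
    LinearMap.mk₂_apply, coe_exteriorPower_map]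
  rw [coe_topWedge _ hl', coe_topWedge _ (by simpa using hl), map_wedgeList, map_wedgeList,
    wedgeList_append]
  refine wedgeList_map_mul_congr i j hij l' hl' _ _ ?_
  simp [Function.comp_def, section_spec]

theorem tmul_ne_zero_of_ne_zero {L M : Type*} [AddCommGroup L] [Module ℝ L]
    [AddCommGroup M] [Module ℝ M] {x : L} {y : M} (hx : x ≠ 0) (hy : y ≠ 0) :
    x ⊗ₜ[ℝ] y ≠ 0 := by
  obtain ⟨f, hf⟩ : ∃ f : Module.Dual ℝ L, f x ≠ 0 := by
    by_contra! h
    exact hx ((Module.forall_dual_apply_eq_zero_iff ℝ x).1 h)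
  intro h
  have h1 := congrArg ((TensorProduct.lid ℝ M).toLinearMap ∘ₗ TensorProduct.map f LinearMap.id) h
  simp [hf, hy] at h1

theorem wedge_ne_zero [FiniteDimensional ℝ V] (i : V' →ₗ[ℝ] V) (j : V →ₗ[ℝ] V'')
    (hi : Function.Injective i) (hij : Function.Exact i j) (hj : Function.Surjective j)
    {x : TopExt V'} {y : TopExt V''} (hx : x ≠ 0) (hy : y ≠ 0) :
    wedge i j hi hij hj (x ⊗ₜ y) ≠ 0 :=
  (LinearEquiv.map_ne_zero_iff _).2 (tmul_ne_zero_of_ne_zero hx hy)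

theorem topWedge_append_ne_zero [FiniteDimensional ℝ V] (i : V' →ₗ[ℝ] V) (j : V →ₗ[ℝ] V'')
    (hi : Function.Injective i) (hij : Function.Exact i j) (hj : Function.Surjective j)
    {l' : List V'} {l : List V} (hl' : topWedge l' ≠ 0) (hl : topWedge (l.map j) ≠ 0) :
    topWedge (l'.map i ++ l) ≠ 0 := by
  rw [← wedge_topWedge i j hi hij hj _ _ (length_of_topWedge_ne_zero hl')
    (by simpa using length_of_topWedge_ne_zero hl)]
  exact wedge_ne_zero i j hi hij hj hl' hl

theorem exists_topWedge_ne_zero (V : Type*) [AddCommGroup V] [Module ℝ V]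
    [FiniteDimensional ℝ V] : ∃ l : List V, topWedge l ≠ 0 := by
  let b := Module.finBasis ℝ V
  have hlen : (List.ofFn b).length = Module.finrank ℝ V := by simp
  have h : wedgeList (List.ofFn b) = ExteriorAlgebra.ιMulti ℝ _ b := by
    rw [wedgeList, ExteriorAlgebra.ιMulti_apply, List.map_ofFn]
    rfl
  refine ⟨List.ofFn b, fun h0 ↦ ?_⟩
  have h1 := congrArg Subtype.val h0
  rw [coe_topWedge _ hlen, h] at h1
  -- The determinant with respect to `b`, extended by zero to the other degrees, takes the value one
  -- on the wedge of `b`.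
  have h2 := congrArg (ExteriorAlgebra.liftAlternating (R := ℝ)
    (Function.update (fun _ ↦ 0) _ b.det)) h1
  rw [ExteriorAlgebra.liftAlternating_apply_ιMulti, Function.update_self, b.det_self] at h2
  simp at h2

theorem exists_map_topWedge_ne_zero {S : Type*} [FiniteDimensional ℝ V''] (j : S → V'')
    (hj : Function.Surjective j) : ∃ l : List S, topWedge (l.map j) ≠ 0 := by
  obtain ⟨l, hl⟩ := exists_topWedge_ne_zero V''
  refine ⟨l.map (Function.surjInv hj), ?_⟩
  simpa [Function.comp_def, Function.surjInv_eq hj] using hl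

/-- A functional on a space with a prescribed nonzero vector. -/
theorem exists_dual_eq_one {L : Type*} [AddCommGroup L] [Module ℝ L] {x : L} (hx : x ≠ 0) :
    ∃ f : Module.Dual ℝ L, f x = 1 := by
  obtain ⟨f, hf⟩ : ∃ f : Module.Dual ℝ L, f x ≠ 0 := by
    by_contra! h
    exact hx ((Module.forall_dual_apply_eq_zero_iff ℝ x).1 h)
  exact ⟨(f x)⁻¹ • f, by simp [hf]⟩

/-- This justifies encoding the dual vector `v*` of a line by the condition `f v = 1`, as is done
throughout. -/
theorem dual_ext_of_finrank_eq_one {L : Type*} [AddCommGroup L] [Module ℝ L]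
    (hL : Module.finrank ℝ L = 1) {x : L} {f g : Module.Dual ℝ L} (hf : f x = 1) (hg : g x = 1) :
    f = g := by
  have hx : x ≠ 0 := by
    rintro rfl
    simp at hf
  ext y
  obtain ⟨c, rfl⟩ := (finrank_eq_one_iff_of_nonzero' x hx).1 hL y
  rw [map_smul, map_smul, hf, hg]

/-- In a commutative square with short exact rows and columns, the two iterated wedge isomorphisms
differ by the sign of the interchange of the two inner factors. -/
theorem wedge_wedge {TL TM TR CL CM CR BL BM BR : Type*}
    [AddCommGroup TL] [Module ℝ TL] [AddCommGroup TM] [Module ℝ TM] [AddCommGroup TR] [Module ℝ TR]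
    [AddCommGroup CL] [Module ℝ CL] [AddCommGroup CM] [Module ℝ CM] [AddCommGroup CR] [Module ℝ CR]
    [AddCommGroup BL] [Module ℝ BL] [AddCommGroup BM] [Module ℝ BM] [AddCommGroup BR] [Module ℝ BR]
    [FiniteDimensional ℝ TM] [FiniteDimensional ℝ CM] [FiniteDimensional ℝ BM]
    [FiniteDimensional ℝ CL] [FiniteDimensional ℝ CR]
    (iT : TL →ₗ[ℝ] TM) (jT : TM →ₗ[ℝ] TR) (iC : CL →ₗ[ℝ] CM) (jC : CM →ₗ[ℝ] CR)
    (iB : BL →ₗ[ℝ] BM) (jB : BM →ₗ[ℝ] BR) (iL : TL →ₗ[ℝ] CL) (jL : CL →ₗ[ℝ] BL)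
    (iM : TM →ₗ[ℝ] CM) (jM : CM →ₗ[ℝ] BM) (iR : TR →ₗ[ℝ] CR) (jR : CR →ₗ[ℝ] BR)
    (hiT : Function.Injective iT) (hT : Function.Exact iT jT) (hjT : Function.Surjective jT)
    (hiC : Function.Injective iC) (hC : Function.Exact iC jC) (hjC : Function.Surjective jC)
    (hiB : Function.Injective iB) (hB : Function.Exact iB jB) (hjB : Function.Surjective jB)
    (hiL : Function.Injective iL) (hL : Function.Exact iL jL) (hjL : Function.Surjective jL)
    (hiM : Function.Injective iM) (hM : Function.Exact iM jM) (hjM : Function.Surjective jM)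
    (hiR : Function.Injective iR) (hR : Function.Exact iR jR) (hjR : Function.Surjective jR)
    (hTL : ∀ x, iM (iT x) = iC (iL x)) (hTR : ∀ x, iR (jT x) = jC (iM x))
    (hBL : ∀ x, jM (iC x) = iB (jL x)) (hBR : ∀ x, jR (jC x) = jB (jM x))
    (x₁ : TopExt TL) (x₂ : TopExt BL) (x₃ : TopExt TR) (x₄ : TopExt BR) :
    wedge iM jM hiM hM hjM (wedge iT jT hiT hT hjT (x₁ ⊗ₜ x₃) ⊗ₜ
        wedge iB jB hiB hB hjB (x₂ ⊗ₜ x₄)) =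
      (-1 : ℝ) ^ (Module.finrank ℝ BL * Module.finrank ℝ TR) •
        wedge iC jC hiC hC hjC (wedge iL jL hiL hL hjL (x₁ ⊗ₜ x₂) ⊗ₜ
          wedge iR jR hiR hR hjR (x₃ ⊗ₜ x₄)) := by
  have : FiniteDimensional ℝ TL := FiniteDimensional.of_injective iT hiT
  have : FiniteDimensional ℝ TR := Module.Finite.of_surjective jT hjT
  have : FiniteDimensional ℝ BL := FiniteDimensional.of_injective iB hiB
  have : FiniteDimensional ℝ BR := Module.Finite.of_surjective jB hjB
  -- A basis of `CM` adapted to the square: `α` in `TL`, `β` in `CL` over `BL`, `γ` in `TM` over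
  -- `TR`, and `ζ` in `CM` itself over `BR`, so that `jM ζ` and `jC ζ` are lifts to `BM` and `CR`.
  -- Both iterated wedges become wedges of these four blocks, with `β` and `γ` in opposite orders.
  obtain ⟨α, hα⟩ := exists_topWedge_ne_zero TL
  obtain ⟨β, hβ⟩ := exists_map_topWedge_ne_zero jL hjL
  obtain ⟨γ, hγ⟩ := exists_map_topWedge_ne_zero jT hjT
  obtain ⟨ζ, hζ⟩ := exists_map_topWedge_ne_zero (fun x ↦ jB (jM x)) (hjB.comp hjM)
  have lα := length_of_topWedge_ne_zero hα
  have lβ := length_of_topWedge_ne_zero hβ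
  have lγ := length_of_topWedge_ne_zero hγ
  have lζ := length_of_topWedge_ne_zero hζ
  rw [List.length_map] at lβ lγ lζ
  obtain ⟨c₁, rfl⟩ := (finrank_eq_one_iff_of_nonzero' _ hα).1 finrank_topExt x₁
  obtain ⟨c₂, rfl⟩ := (finrank_eq_one_iff_of_nonzero' _ hβ).1 finrank_topExt x₂
  obtain ⟨c₃, rfl⟩ := (finrank_eq_one_iff_of_nonzero' _ hγ).1 finrank_topExt x₃
  obtain ⟨c₄, rfl⟩ := (finrank_eq_one_iff_of_nonzero' _ hζ).1 finrank_topExt x₄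
  have nT := finrank_of_ses iT jT hiT hT hjT
  have nB := finrank_of_ses iB jB hiB hB hjB
  have nL := finrank_of_ses iL jL hiL hL hjL
  have nR := finrank_of_ses iR jR hiR hR hjR
  have key : wedge iM jM hiM hM hjM (wedge iT jT hiT hT hjT (topWedge α ⊗ₜ topWedge (γ.map jT)) ⊗ₜ
        wedge iB jB hiB hB hjB (topWedge (β.map jL) ⊗ₜ topWedge (ζ.map fun x ↦ jB (jM x)))) =
      (-1 : ℝ) ^ (Module.finrank ℝ BL * Module.finrank ℝ TR) •
        wedge iC jC hiC hC hjC (wedge iL jL hiL hL hjL (topWedge α ⊗ₜ topWedge (β.map jL)) ⊗ₜ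
          wedge iR jR hiR hR hjR (topWedge (γ.map jT) ⊗ₜ
            topWedge (ζ.map fun x ↦ jB (jM x)))) := by
    have e1 : (ζ.map fun x ↦ jB (jM x)) = (ζ.map jM).map jB := by simp [Function.comp_def]
    have e2 : (ζ.map fun x ↦ jB (jM x)) = (ζ.map jC).map jR := by simp [Function.comp_def, hBR]
    rw [wedge_topWedge _ _ _ _ _ _ _ lα lγ, wedge_topWedge _ _ _ _ _ _ _ lα lβ]
    rw [e1, wedge_topWedge _ _ _ _ _ _ _ (by simpa using lβ) (by simpa using lζ), ← e1, e2,
      wedge_topWedge _ _ _ _ _ _ _ (by simpa using lγ) (by simpa using lζ)]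
    have e3 : (β.map jL).map iB ++ ζ.map jM = (β.map iC ++ ζ).map jM := by
      simp [Function.comp_def, hBL]
    have e4 : (γ.map jT).map iR ++ ζ.map jC = (γ.map iM ++ ζ).map jC := by
      simp [Function.comp_def, hTR]
    rw [e3, e4, wedge_topWedge _ _ _ _ _ _ _ (by simp; omega) (by simp; omega),
      wedge_topWedge _ _ _ _ _ _ _ (by simp; omega) (by simp; omega)]
    have e5 := topWedge_swap (α.map fun x ↦ iM (iT x)) (γ.map iM) (β.map iC) ζ
    simp only [List.length_map, lβ, lγ] at e5
    rw [mul_comm (Module.finrank ℝ BL)]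
    simpa [Function.comp_def, hTL] using e5
  simp only [← TensorProduct.smul_tmul', TensorProduct.tmul_smul, map_smul, key]
  simp only [smul_smul]
  congr 1
  ring

end WedgeList

/-! ### Signs and wedge products of dual lines. -/

section WedgeDual

variable {V V' V'' : Type*} [AddCommGroup V] [Module ℝ V] [AddCommGroup V'] [Module ℝ V']
  [AddCommGroup V''] [Module ℝ V'']

theorem signEquiv_apply {L : Type*} [AddCommMonoid L] [Module ℝ L] (k : ℤ) (x : L) :
    signEquiv L k x = (-1 : ℝ) ^ k • x := by
  simp [signEquiv, LinearEquiv.smulOfUnit, Units.smul_def]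

theorem neg_one_zpow_congr {a b : ℤ} (h : Even (a - b)) : (-1 : ℝ) ^ a = (-1 : ℝ) ^ b := by
  rw [← sub_add_cancel a b, zpow_add₀ (by norm_num), h.neg_one_zpow, one_mul]

/-- The isomorphism `λ*(V') ⊗ λ*(V'') ≃ λ*(V)`, `x* ⊗ y* ↦ (x ∧ y)*`, of a short exact sequence. -/
def wedgeDual [FiniteDimensional ℝ V] [FiniteDimensional ℝ V'] [FiniteDimensional ℝ V'']
    (i : V' →ₗ[ℝ] V) (j : V →ₗ[ℝ] V'')
    (hi : Function.Injective i) (hij : Function.Exact i j) (hj : Function.Surjective j) :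
    TopExtDual V' ⊗[ℝ] TopExtDual V'' ≃ₗ[ℝ] TopExtDual V :=
  TensorProduct.dualDistribEquiv ℝ _ _ ≪≫ₗ (wedge i j hi hij hj).symm.dualMap

theorem wedgeDual_apply_wedge [FiniteDimensional ℝ V] [FiniteDimensional ℝ V']
    [FiniteDimensional ℝ V''] (i : V' →ₗ[ℝ] V) (j : V →ₗ[ℝ] V'')
    (hi : Function.Injective i) (hij : Function.Exact i j) (hj : Function.Surjective j)
    (f : TopExtDual V') (g : TopExtDual V'') (x : TopExt V') (y : TopExt V'') :
    wedgeDual i j hi hij hj (f ⊗ₜ g) (wedge i j hi hij hj (x ⊗ₜ y)) = f x * g y := by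
  simp only [wedgeDual, LinearEquiv.trans_apply, LinearEquiv.dualMap_apply,
    LinearEquiv.symm_apply_apply]
  exact TensorProduct.dualDistrib_apply f g x y

theorem eq_wedgeDual_of_apply_eq_one [FiniteDimensional ℝ V] [FiniteDimensional ℝ V']
    [FiniteDimensional ℝ V''] (i : V' →ₗ[ℝ] V) (j : V →ₗ[ℝ] V'')
    (hi : Function.Injective i) (hij : Function.Exact i j) (hj : Function.Surjective j)
    {f : TopExtDual V'} {g : TopExtDual V''} {h : TopExtDual V} {x : TopExt V'} {y : TopExt V''}
    (hf : f x = 1) (hg : g y = 1) (hh : h (wedge i j hi hij hj (x ⊗ₜ y)) = 1) :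
    h = wedgeDual i j hi hij hj (f ⊗ₜ g) :=
  dual_ext_of_finrank_eq_one finrank_topExt hh
    (by rw [wedgeDual_apply_wedge, hf, hg, one_mul])

theorem map_subtype_rangeRestrict {V W : Type*} [AddCommGroup V] [Module ℝ V] [AddCommGroup W]
    [Module ℝ W] (f : V →ₗ[ℝ] W) (l : List V) :
    (l.map f.rangeRestrict).map (LinearMap.range f).subtype = l.map f := by
  simp [Function.comp_def]

end WedgeDual

variable {X Y X' Y' X'' Y'' : Type*}
  [NormedAddCommGroup X] [NormedSpace ℝ X] [CompleteSpace X]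
  [NormedAddCommGroup Y] [NormedSpace ℝ Y] [CompleteSpace Y]
  [NormedAddCommGroup X'] [NormedSpace ℝ X'] [CompleteSpace X']
  [NormedAddCommGroup Y'] [NormedSpace ℝ Y'] [CompleteSpace Y']
  [NormedAddCommGroup X''] [NormedSpace ℝ X''] [CompleteSpace X'']
  [NormedAddCommGroup Y''] [NormedSpace ℝ Y''] [CompleteSpace Y'']

/-! ### The defining formula of `Ψ`. -/

section Psi

variable {D' : FredholmOp X' Y'} {D : FredholmOp X Y} {D'' : FredholmOp X'' Y''}
  (t : ExactTriple D' D D'')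

theorem ExactTriple.exact_ker_rangeRestrict : Function.Exact t.iKer t.jKer.rangeRestrict := by
  rw [LinearMap.exact_iff, LinearMap.ker_rangeRestrict]
  exact t.exact_ker.linearMap_ker_eq

theorem ExactTriple.exact_ker'' :
    Function.Exact (LinearMap.range t.jKer).subtype t.delta.rangeRestrict := by
  rw [LinearMap.exact_iff, LinearMap.ker_rangeRestrict, Submodule.range_subtype]
  exact t.exact_jKer_delta.linearMap_ker_eq

theorem ExactTriple.exact_coker' :
    Function.Exact (LinearMap.range t.delta).subtype t.iCoker.rangeRestrict := by
  rw [LinearMap.exact_iff, LinearMap.ker_rangeRestrict, Submodule.range_subtype]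
  exact t.exact_delta_iCoker.linearMap_ker_eq

theorem ExactTriple.exact_coker_subtype :
    Function.Exact (LinearMap.range t.iCoker).subtype t.jCoker := by
  rw [LinearMap.exact_iff, Submodule.range_subtype]
  exact t.exact_coker.linearMap_ker_eq

/-- Here `f'`, `f''` and `f` play the roles of `(v ∧ w)*`, `y*` and `(w ∧ y)*`. Choosing `g = v*`
and `h = w*` splits `f'` as `g ⊗ h`; then `g` is contracted against `v` and `h` is joined with
`f''`. -/
theorem ExactTriple.psi_tmul {x : TopExt D'.Ker} {u : TopExt (LinearMap.range t.jKer)}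
    {v : TopExt (LinearMap.range t.delta)} {w : TopExt (LinearMap.range t.iCoker)}
    {y : TopExt D''.Coker} {f' : TopExtDual D'.Coker} {f'' : TopExtDual D''.Coker}
    {f : TopExtDual D.Coker} (hf' : f' (t.wedgeCoker' (v ⊗ₜ w)) = 1) (hf'' : f'' y = 1)
    (hf : f (t.wedgeCoker (w ⊗ₜ y)) = 1) :
    t.psi ((x ⊗ₜ f') ⊗ₜ (t.wedgeKer'' (u ⊗ₜ v) ⊗ₜ f'')) =
      (-1 : ℝ) ^ t.eps • (t.wedgeKer (x ⊗ₜ u) ⊗ₜ f) := by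
  have hvw : v ⊗ₜ[ℝ] w ≠ 0 := by
    intro h
    rw [h, LinearEquiv.map_zero, LinearMap.map_zero] at hf'
    exact zero_ne_one hf'
  obtain ⟨g, hg⟩ : ∃ g : TopExtDual (LinearMap.range t.delta), g v = 1 :=
    exists_dual_eq_one (by rintro rfl; simp at hvw)
  obtain ⟨h, hh⟩ : ∃ h : TopExtDual (LinearMap.range t.iCoker), h w = 1 :=
    exists_dual_eq_one (by rintro rfl; simp at hvw)
  have h1 : t.wedgeCoker'.dualMap f' = TensorProduct.dualDistribEquiv ℝ _ _ (g ⊗ₜ h) := by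
    refine dual_ext_of_finrank_eq_one (x := v ⊗ₜ[ℝ] w) ?_ hf' ?_
    · rw [Module.finrank_tensorProduct, finrank_topExt, finrank_topExt]
    · exact (TensorProduct.dualDistrib_apply g h v w).trans (by rw [hg, hh, one_mul])
  have h2 : t.wedgeCoker.symm.dualMap (TensorProduct.dualDistribEquiv ℝ _ _ (h ⊗ₜ f'')) = f := by
    refine dual_ext_of_finrank_eq_one finrank_topExt ?_ hf
    rw [LinearEquiv.dualMap_apply, LinearEquiv.symm_apply_apply]
    exact (TensorProduct.dualDistrib_apply h f'' w y).trans (by rw [hf'', hh, one_mul])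
  have h3 : t.psiKer (x ⊗ₜ t.wedgeKer'' (u ⊗ₜ v)) = t.wedgeKer (x ⊗ₜ u) ⊗ₜ v := by
    simp [psiKer]
  have h4 : t.psiCoker (f' ⊗ₜ f'') = g ⊗ₜ f := by
    simp only [psiCoker, LinearEquiv.trans_apply, TensorProduct.congr_tmul, h1,
      LinearEquiv.symm_apply_apply, LinearEquiv.refl_apply, TensorProduct.assoc_tmul, h2]
  have h5 : evalEquiv _ finrank_topExt (v ⊗ₜ g) = 1 := hg
  simp only [psi, LinearEquiv.trans_apply, TensorProduct.tensorTensorTensorComm_tmul,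
    TensorProduct.congr_tmul, h3, h4, TensorProduct.assoc_tmul, TensorProduct.assoc_symm_tmul,
    LinearEquiv.refl_apply, h5, TensorProduct.lid_tmul, one_smul, signEquiv_apply]

end Psi

/-! ### Finite-dimensional models and their determinant lines. -/

/-- A finite-dimensional model of a Fredholm operator `D`: a linear map `d : K → E` between
finite-dimensional spaces together with identifications of its kernel and cokernel with those
of `D`. -/
structure FiniteModel (D : FredholmOp X Y) (K E : Type*) [AddCommGroup K] [Module ℝ K]
    [AddCommGroup E] [Module ℝ E] where
  a : D.Ker →ₗ[ℝ] K
  d : K →ₗ[ℝ] E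
  q : E →ₗ[ℝ] D.Coker
  a_injective : Function.Injective a
  exact_a : Function.Exact a d
  exact_q : Function.Exact d q
  q_surjective : Function.Surjective q

namespace FiniteModel

variable {D : FredholmOp X Y} {K E : Type*} [AddCommGroup K] [Module ℝ K]
  [AddCommGroup E] [Module ℝ E] (m : FiniteModel D K E)

theorem exact_rangeRestrict : Function.Exact m.a m.d.rangeRestrict := by
  rw [LinearMap.exact_iff, LinearMap.ker_rangeRestrict]
  exact m.exact_a.linearMap_ker_eq

theorem exact_subtype : Function.Exact (LinearMap.range m.d).subtype m.q := by
  rw [LinearMap.exact_iff, Submodule.range_subtype]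
  exact m.exact_q.linearMap_ker_eq

theorem finrank_ker_add [FiniteDimensional ℝ K] : Module.finrank ℝ D.Ker + Module.finrank ℝ (LinearMap.range m.d) =
    Module.finrank ℝ K :=
  finrank_of_ses _ _ m.a_injective m.exact_rangeRestrict m.d.surjective_rangeRestrict

theorem finrank_range_add [FiniteDimensional ℝ E] : Module.finrank ℝ (LinearMap.range m.d) + Module.finrank ℝ D.Coker =
    Module.finrank ℝ E :=
  finrank_of_ses _ _ (Submodule.subtype_injective _) m.exact_subtype m.q_surjective

variable [FiniteDimensional ℝ K] [FiniteDimensional ℝ E]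

theorem index_eq (m : FiniteModel D K E) : D.index = (Module.finrank ℝ K : ℤ) - Module.finrank ℝ E := by
  have h1 := m.finrank_ker_add
  have h2 := m.finrank_range_add
  rw [FredholmOp.index]
  omega

/-- `λ(κ(D)) ⊗ λ(Im d) ≃ λ(K)`. -/
def wedgeK : TopExt D.Ker ⊗[ℝ] TopExt (LinearMap.range m.d) ≃ₗ[ℝ] TopExt K :=
  wedge m.a m.d.rangeRestrict m.a_injective m.exact_rangeRestrict m.d.surjective_rangeRestrict

/-- `λ*(Im d) ⊗ λ*(𝔠(D)) ≃ λ*(E)`. -/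
def wedgeDualE : TopExtDual (LinearMap.range m.d) ⊗[ℝ] TopExtDual D.Coker ≃ₗ[ℝ] TopExtDual E :=
  wedgeDual (LinearMap.range m.d).subtype m.q (Submodule.subtype_injective _) m.exact_subtype
    m.q_surjective

/-- The isomorphism `λ(K) ⊗ λ*(E) ≃ λ(D)`, `(x ∧ v) ⊗ (v ∧ y)* ↦ ± x ⊗ y*` for `v ∈ λ(Im d)`. -/
def detEquiv : TopExt K ⊗[ℝ] TopExtDual E ≃ₗ[ℝ] D.DetLine :=
  TensorProduct.congr m.wedgeK.symm m.wedgeDualE.symm ≪≫ₗ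
    TensorProduct.assoc ℝ _ _ _ ≪≫ₗ
    TensorProduct.congr (LinearEquiv.refl ℝ _)
      ((TensorProduct.assoc ℝ _ _ _).symm ≪≫ₗ
        TensorProduct.congr (evalEquiv _ finrank_topExt) (LinearEquiv.refl ℝ _) ≪≫ₗ
        TensorProduct.lid ℝ _) ≪≫ₗ
    -- This exponent is what makes the sign in `TripleModel.psi_detEquiv` depend only on `ind D''`
    -- and `dim E'`. It is even when `dim E = dim 𝔠(D)`, that is, when `d = 0`.
    signEquiv _ (Module.finrank ℝ D.Coker * (Module.finrank ℝ E + 1))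

/-- The form of `detEquiv` used on bases: `e` lifts a basis of `Im d`, `c` lifts a basis of the
cokernel, `f = (d e ∧ c)*` and `g = (q c)*`. The factor `d e` cancels against its dual. -/
theorem detEquiv_topWedge {k : List D.Ker} {e : List K} {c : List E}
    {f : TopExtDual E} {g : TopExtDual D.Coker} (hk : topWedge k ≠ 0)
    (he : e.length = Module.finrank ℝ (LinearMap.range m.d))
    (hf : f (topWedge (e.map m.d ++ c)) = 1) (hg : g (topWedge (c.map m.q)) = 1) :
    m.detEquiv (topWedge (k.map m.a ++ e) ⊗ₜ f) =
      (-1 : ℝ) ^ ((Module.finrank ℝ D.Coker : ℤ) * (Module.finrank ℝ E + 1)) •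
        (topWedge k ⊗ₜ g) := by
  have hc : topWedge (c.map m.q) ≠ 0 := by
    intro h0
    rw [h0, map_zero] at hg
    exact zero_ne_one hg
  have lk := length_of_topWedge_ne_zero hk
  have lc := length_of_topWedge_ne_zero hc
  rw [List.length_map] at lc
  have hec : wedge _ _ (Submodule.subtype_injective _) m.exact_subtype m.q_surjective
      (topWedge (e.map m.d.rangeRestrict) ⊗ₜ topWedge (c.map m.q)) = topWedge (e.map m.d ++ c) := by
    rw [wedge_topWedge _ _ _ _ _ _ _ (by simpa using he) lc, map_subtype_rangeRestrict]
  obtain ⟨h, hh⟩ : ∃ h : TopExtDual (LinearMap.range m.d),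
      h (topWedge (e.map m.d.rangeRestrict)) = 1 := exists_dual_eq_one (by
    intro h0
    rw [← hec, h0, TensorProduct.zero_tmul, LinearEquiv.map_zero, LinearMap.map_zero] at hf
    exact zero_ne_one hf)
  have h1 : topWedge (k.map m.a ++ e) = m.wedgeK (topWedge k ⊗ₜ topWedge (e.map m.d.rangeRestrict)) :=
    (wedge_topWedge _ _ _ _ _ _ _ lk (by simpa using he)).symm
  have h2 : f = m.wedgeDualE (h ⊗ₜ g) := by
    refine eq_wedgeDual_of_apply_eq_one _ _ _ _ _ hh hg ?_
    rwa [hec]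
  have h5 : evalEquiv _ finrank_topExt (topWedge (e.map m.d.rangeRestrict) ⊗ₜ h) = 1 := hh
  simp only [detEquiv, LinearEquiv.trans_apply, TensorProduct.congr_tmul, h1, h2,
    LinearEquiv.symm_apply_apply, TensorProduct.assoc_tmul, TensorProduct.assoc_symm_tmul,
    LinearEquiv.refl_apply, h5, TensorProduct.lid_tmul, one_smul, signEquiv_apply]

end FiniteModel

/-! ### `Ψ` computed in compatible models of a triple. -/

/-- Compatibility of finite-dimensional models of the three operators of an exact triple. -/
structure TripleModel {D' : FredholmOp X' Y'} {D : FredholmOp X Y} {D'' : FredholmOp X'' Y''}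
    (t : ExactTriple D' D D'') {K' E' K E K'' E'' : Type*}
    [AddCommGroup K'] [Module ℝ K'] [AddCommGroup E'] [Module ℝ E']
    [AddCommGroup K] [Module ℝ K] [AddCommGroup E] [Module ℝ E]
    [AddCommGroup K''] [Module ℝ K''] [AddCommGroup E''] [Module ℝ E'']
    (m' : FiniteModel D' K' E') (m : FiniteModel D K E) (m'' : FiniteModel D'' K'' E'') where
  iK : K' →ₗ[ℝ] K
  jK : K →ₗ[ℝ] K''
  iE : E' →ₗ[ℝ] E
  jE : E →ₗ[ℝ] E''
  iK_injective : Function.Injective iK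
  exactK : Function.Exact iK jK
  jK_surjective : Function.Surjective jK
  iE_injective : Function.Injective iE
  exactE : Function.Exact iE jE
  jE_surjective : Function.Surjective jE
  comm_iK : ∀ k, m.d (iK k) = iE (m'.d k)
  comm_jK : ∀ k, m''.d (jK k) = jE (m.d k)
  iKer_eq : ∀ x, m.a (t.iKer x) = iK (m'.a x)
  jKer_eq : ∀ x, m''.a (t.jKer x) = jK (m.a x)
  iCoker_eq : ∀ y, t.iCoker (m'.q y) = m.q (iE y)
  jCoker_eq : ∀ y, t.jCoker (m.q y) = m''.q (jE y)
  delta_eq : ∀ x k e, jK k = m''.a x → iE e = m.d k → t.delta x = m'.q e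

namespace TripleModel

variable {D' : FredholmOp X' Y'} {D : FredholmOp X Y} {D'' : FredholmOp X'' Y''}
    {t : ExactTriple D' D D''} {K' E' K E K'' E'' : Type*}
    [AddCommGroup K'] [Module ℝ K'] [AddCommGroup E'] [Module ℝ E']
    [AddCommGroup K] [Module ℝ K] [AddCommGroup E] [Module ℝ E]
    [AddCommGroup K''] [Module ℝ K''] [AddCommGroup E''] [Module ℝ E'']
    {m' : FiniteModel D' K' E'} {m : FiniteModel D K E} {m'' : FiniteModel D'' K'' E''}
    (T : TripleModel t m' m m'')

theorem exists_lift (x : D''.Ker) : ∃ (k : K) (e : E'), T.jK k = m''.a x ∧ T.iE e = m.d k := by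
  obtain ⟨k, hk⟩ := T.jK_surjective (m''.a x)
  obtain ⟨e, he⟩ := (T.exactE (m.d k)).1 (by
    rw [← T.comm_jK, hk, m''.exact_a.apply_apply_eq_zero])
  exact ⟨k, e, hk, he⟩

variable [FiniteDimensional ℝ K'] [FiniteDimensional ℝ E'] [FiniteDimensional ℝ K]
  [FiniteDimensional ℝ E] [FiniteDimensional ℝ K''] [FiniteDimensional ℝ E'']

/-- `λ(K') ⊗ λ(K'') ≃ λ(K)`. -/
def wedgeK : TopExt K' ⊗[ℝ] TopExt K'' ≃ₗ[ℝ] TopExt K :=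
  wedge T.iK T.jK T.iK_injective T.exactK T.jK_surjective

/-- `λ*(E') ⊗ λ*(E'') ≃ λ*(E)`. -/
def wedgeDualE : TopExtDual E' ⊗[ℝ] TopExtDual E'' ≃ₗ[ℝ] TopExtDual E :=
  wedgeDual T.iE T.jE T.iE_injective T.exactE T.jE_surjective

/-- The parity count for `exists_generators`. The variables stand for the ranks of `jKer`, `δ` and
`iCoker`, `dim 𝔠(D'')`, and the ranks of `m'.d` and `m''.d`; the terms `p * b` and `s * t` come from
reordering basis blocks. Only residues modulo two matter, which leaves finitely many cases. -/
theorem even_psi_sign_sub (b r s m p t : ℤ) :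
    Even ((((b + r) - m) * (r + s) + (s + m) * r + (r + s) * ((p + (r + s)) + 1) +
      m * ((t + m) + 1)) -
      (((b + r) - m) * (p + (r + s)) + (p * b + s * t) +
        (s + m) * (((p + (r + s)) + (t + m)) + 1))) := by
  rw [← ZMod.intCast_eq_zero_iff_even]
  push_cast
  generalize (b : ZMod 2) = b
  revert b
  generalize (r : ZMod 2) = b; revert b
  generalize (s : ZMod 2) = b; revert b
  generalize (m : ZMod 2) = b; revert b
  generalize (p : ZMod 2) = b; revert b
  generalize (t : ZMod 2) = b; revert b
  decide

-- All terms are evaluated on bases adapted to the snake sequence and to the models. With the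
-- inclusions omitted, `K'` has basis `x, e'`; `K''` has `u, v, e''`; `E'` has `d e', vE, W`; `E''`
-- has `d e'', Y`. Consequently `K` has `x, u, e', vK, e''` and `E` has `d e', d vK, d e'', W, Y`,
-- where `d vK` is the image of `vE`. Getting to these orders from the concatenated bases moves `u`
-- past `e'` in `K` and `W` past `d e''` in `E`.
set_option maxHeartbeats 1000000 in
theorem exists_generators : ∃ (x₀' : TopExt K') (x₀'' : TopExt K'') (f₀' : TopExtDual E')
    (f₀'' : TopExtDual E''), x₀' ≠ 0 ∧ x₀'' ≠ 0 ∧ f₀' ≠ 0 ∧ f₀'' ≠ 0 ∧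
    t.psi (m'.detEquiv (x₀' ⊗ₜ f₀') ⊗ₜ m''.detEquiv (x₀'' ⊗ₜ f₀'')) =
      (-1 : ℝ) ^ (D''.index * Module.finrank ℝ E') •
        m.detEquiv (T.wedgeK (x₀' ⊗ₜ x₀'') ⊗ₜ T.wedgeDualE (f₀' ⊗ₜ f₀'')) := by
  obtain ⟨x, hx⟩ := exists_topWedge_ne_zero D'.Ker
  obtain ⟨u, hu⟩ := exists_map_topWedge_ne_zero _ t.jKer.surjective_rangeRestrict
  obtain ⟨v, hv⟩ := exists_map_topWedge_ne_zero _ t.delta.surjective_rangeRestrict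
  obtain ⟨W, hW⟩ := exists_map_topWedge_ne_zero (fun z ↦ t.iCoker.rangeRestrict (m'.q z))
    (t.iCoker.surjective_rangeRestrict.comp m'.q_surjective)
  obtain ⟨Y, hY⟩ := exists_map_topWedge_ne_zero (fun z ↦ m''.q (T.jE z))
    (m''.q_surjective.comp T.jE_surjective)
  obtain ⟨e', he'⟩ := exists_map_topWedge_ne_zero _ m'.d.surjective_rangeRestrict
  obtain ⟨e'', he''⟩ := exists_map_topWedge_ne_zero (fun z ↦ m''.d.rangeRestrict (T.jK z))
    (m''.d.surjective_rangeRestrict.comp T.jK_surjective)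
  -- The snake construction inside the models: `vK z` lifts `z` to `K`, and `vE z` in `E'` maps to
  -- `d (vK z)`, so it represents `δ z`. The block `v` therefore appears in `Im d` for `D` but in
  -- the cokernel for `D'`.
  choose vK vE hvK hvE using T.exists_lift
  have hδ : ∀ z, t.delta z = m'.q (vE z) := fun z ↦ T.delta_eq _ _ _ (hvK z) (hvE z)
  have hW' : topWedge ((W.map m'.q).map t.iCoker.rangeRestrict) ≠ 0 := by
    simpa [Function.comp_def] using hW
  have hY' : topWedge ((Y.map T.jE).map m''.q) ≠ 0 := by simpa [Function.comp_def] using hY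
  have he2 : topWedge ((e''.map T.jK).map m''.d.rangeRestrict) ≠ 0 := by
    simpa [Function.comp_def] using he''
  have lx := length_of_topWedge_ne_zero hx
  have lu := length_of_topWedge_ne_zero hu
  have lv := length_of_topWedge_ne_zero hv
  have lW := length_of_topWedge_ne_zero hW'
  have lY := length_of_topWedge_ne_zero hY'
  have le' := length_of_topWedge_ne_zero he'
  have le'' := length_of_topWedge_ne_zero he2
  have hc' := topWedge_append_ne_zero _ _ (Submodule.subtype_injective _) t.exact_coker'
    t.iCoker.surjective_rangeRestrict hv hW'
  have hc := topWedge_append_ne_zero _ _ (Submodule.subtype_injective _) t.exact_coker_subtype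
    t.jCoker_surjective (l := Y.map m.q) hW' (by
      simpa [Function.comp_def, T.jCoker_eq] using hY')
  have hk := topWedge_append_ne_zero _ _ t.iKer_injective t.exact_ker_rangeRestrict
    t.jKer.surjective_rangeRestrict hx hu
  have hk'' := topWedge_append_ne_zero _ _ (Submodule.subtype_injective _) t.exact_ker''
    t.delta.surjective_rangeRestrict hu hv
  have hK' := topWedge_append_ne_zero _ _ m'.a_injective m'.exact_rangeRestrict
    m'.d.surjective_rangeRestrict hx he'
  have hK'' := topWedge_append_ne_zero _ _ m''.a_injective m''.exact_rangeRestrict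
    m''.d.surjective_rangeRestrict hk'' he2
  have hvW : (v.map vE ++ W).map m'.q =
      (v.map t.delta.rangeRestrict).map (LinearMap.range t.delta).subtype ++ W.map m'.q := by
    simp [Function.comp_def, hδ]
  have hE' := topWedge_append_ne_zero _ _ (Submodule.subtype_injective _) m'.exact_subtype
    m'.q_surjective (l := v.map vE ++ W) he' (by rwa [hvW])
  have hE'' := topWedge_append_ne_zero _ _ (Submodule.subtype_injective _) m''.exact_subtype
    m''.q_surjective he2 hY'
  have hK := topWedge_append_ne_zero _ _ T.iK_injective T.exactK T.jK_surjective
    (l := u.map m.a ++ (v.map vK ++ e'')) hK' (by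
      convert hK'' using 2
      simp [Function.comp_def, hvK, T.jKer_eq])

  simp only [map_subtype_rangeRestrict] at hc' hc hk'' hK'' hE' hE'' hvW
  obtain ⟨f', hf'⟩ := exists_dual_eq_one hE'
  obtain ⟨f'', hf''⟩ := exists_dual_eq_one hE''
  obtain ⟨g', hg'⟩ := exists_dual_eq_one hc'
  obtain ⟨g'', hg''⟩ := exists_dual_eq_one hY'
  obtain ⟨g, hg⟩ := exists_dual_eq_one hc
  simp only [List.length_map] at lx lu lv lW lY le' le''
  have n1 := finrank_of_ses _ _ t.iKer_injective t.exact_ker_rangeRestrict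
    t.jKer.surjective_rangeRestrict
  have n2 := finrank_of_ses _ _ (Submodule.subtype_injective _) t.exact_ker''
    t.delta.surjective_rangeRestrict
  have n3 := finrank_of_ses _ _ (Submodule.subtype_injective _) t.exact_coker'
    t.iCoker.surjective_rangeRestrict
  have n4 := finrank_of_ses _ _ (Submodule.subtype_injective _) t.exact_coker_subtype
    t.jCoker_surjective
  have n5 := m'.finrank_range_add
  have n6 := m''.finrank_range_add
  have n7 := m.finrank_range_add
  have n8 := finrank_of_ses _ _ T.iE_injective T.exactE T.jE_surjective
  have n9 := m'.finrank_ker_add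
  have n10 := m''.finrank_ker_add
  have hJ' := m'.detEquiv_topWedge (f := f') (g := g') (c := v.map vE ++ W) hx le' hf'
    (by rwa [hvW])
  have hJ'' := m''.detEquiv_topWedge (f := f'') (g := g'') (c := Y.map T.jE) hk''
    (by simpa using le'') hf'' hg''
  have hwK : T.wedgeK (topWedge (x.map m'.a ++ e') ⊗ₜ
      topWedge ((u.map t.jKer ++ v).map m''.a ++ e''.map T.jK)) =
      (-1 : ℝ) ^ (e'.length * u.length) •
        topWedge ((x.map t.iKer ++ u).map m.a ++ (e'.map T.iK ++ (v.map vK ++ e''))) := by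
    have h1 : (u.map t.jKer ++ v).map m''.a ++ e''.map T.jK =
        (u.map m.a ++ (v.map vK ++ e'')).map T.jK := by
      simp [Function.comp_def, hvK, T.jKer_eq]
    have h2 := topWedge_swap (x.map fun z ↦ T.iK (m'.a z)) (e'.map T.iK) (u.map m.a)
      (v.map vK ++ e'')
    rw [h1, wedgeK, wedge_topWedge _ _ _ _ _ _ _ (by simp; omega) (by simp; omega)]
    simpa [Function.comp_def, T.iKer_eq] using h2
  have hwE : wedge T.iE T.jE T.iE_injective T.exactE T.jE_surjective
      (topWedge (e'.map m'.d ++ (v.map vE ++ W)) ⊗ₜ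
        topWedge ((e''.map T.jK).map m''.d ++ Y.map T.jE)) =
      (-1 : ℝ) ^ (W.length * e''.length) •
        topWedge ((e'.map T.iK ++ (v.map vK ++ e'')).map m.d ++ (W.map T.iE ++ Y)) := by
    have h1 : (e''.map T.jK).map m''.d ++ Y.map T.jE = (e''.map m.d ++ Y).map T.jE := by
      simp [Function.comp_def, T.comm_jK]
    have h2 := topWedge_swap ((e'.map fun z ↦ T.iE (m'.d z)) ++ v.map fun z ↦ T.iE (vE z))
      (W.map T.iE) (e''.map m.d) Y
    rw [h1, wedge_topWedge _ _ _ _ _ _ _ (by simp; omega) (by simp; omega)]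
    simpa [Function.comp_def, T.comm_iK, hvE] using h2
  -- The reordering sign is its own inverse, so this multiple of the functional is the one dual to
  -- the reordered basis of `E`.
  have hwD : ((-1 : ℝ) ^ (W.length * e''.length) • T.wedgeDualE (f' ⊗ₜ f''))
      (topWedge ((e'.map T.iK ++ (v.map vK ++ e'')).map m.d ++ (W.map T.iE ++ Y))) = 1 := by
    rw [LinearMap.smul_apply, ← map_smul, ← hwE, wedgeDualE, wedgeDual_apply_wedge, hf', hf'',
      one_mul]
  have hJ := m.detEquiv_topWedge (k := x.map t.iKer ++ u) (e := e'.map T.iK ++ (v.map vK ++ e''))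
    (c := W.map T.iE ++ Y) (g := g) hk (by simp; omega) hwD (by
      convert hg using 2
      simp [Function.comp_def, T.iCoker_eq])
  have hΨ := t.psi_tmul (x := topWedge x) (u := topWedge (u.map t.jKer.rangeRestrict))
    (v := topWedge (v.map t.delta.rangeRestrict))
    (w := topWedge ((W.map m'.q).map t.iCoker.rangeRestrict))
    (y := topWedge ((Y.map T.jE).map m''.q)) (f' := g') (f'' := g'') (f := g)
    (by
      rw [ExactTriple.wedgeCoker', wedge_topWedge _ _ _ _ _ _ _ (by simpa using lv)
        (by simpa using lW), map_subtype_rangeRestrict]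
      exact hg') hg''
    (by
      have h1 : (Y.map T.jE).map m''.q = (Y.map m.q).map t.jCoker := by
        simp [Function.comp_def, T.jCoker_eq]
      rw [h1, ExactTriple.wedgeCoker, wedge_topWedge _ _ _ _ _ _ _ (by simpa using lW)
        (by simpa using lY), map_subtype_rangeRestrict]
      exact hg)
  rw [ExactTriple.wedgeKer'', wedge_topWedge _ _ _ _ _ _ _ (by simpa using lu) (by simpa using lv),
    map_subtype_rangeRestrict, ExactTriple.wedgeKer,
    wedge_topWedge _ _ _ _ _ _ _ (by simpa using lx) (by simpa using lu)] at hΨ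
  refine ⟨_, _, f', f'', hK', hK'', ?_, ?_, ?_⟩
  · rintro rfl
    simp at hf'
  · rintro rfl
    simp at hf''
  have hJ2 : m.detEquiv (topWedge ((x.map t.iKer ++ u).map m.a ++
      (e'.map T.iK ++ (v.map vK ++ e''))) ⊗ₜ T.wedgeDualE (f' ⊗ₜ f'')) =
      (-1 : ℝ) ^ (W.length * e''.length) •
        (-1 : ℝ) ^ ((Module.finrank ℝ D.Coker : ℤ) * (Module.finrank ℝ E + 1)) •
        (topWedge (x.map t.iKer ++ u) ⊗ₜ g) := by
    rw [← hJ, TensorProduct.tmul_smul, map_smul, smul_smul, ← mul_pow, neg_one_mul, neg_neg,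
      one_pow, one_smul]
  rw [hJ', hJ'', ← TensorProduct.smul_tmul', map_smul, TensorProduct.tmul_smul, map_smul, hΨ, hwK,
    ← TensorProduct.smul_tmul', map_smul, hJ2]
  simp only [smul_smul]
  congr 1
  simp only [← zpow_natCast, ← zpow_add₀ (show (-1 : ℝ) ≠ 0 by norm_num)]
  apply neg_one_zpow_congr
  simp only [ExactTriple.eps, FredholmOp.index, ← n8, ← n5, ← n6, ← n4, ← n3, ← n2, lW, le', le'', lu]
  push_cast
  have key := even_psi_sign_sub (Module.finrank ℝ (LinearMap.range t.jKer))
    (Module.finrank ℝ (LinearMap.range t.delta)) (Module.finrank ℝ (LinearMap.range t.iCoker))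
    (Module.finrank ℝ D''.Coker) (Module.finrank ℝ (LinearMap.range m'.d))
    (Module.finrank ℝ (LinearMap.range m''.d))
  ring_nf at key ⊢
  exact key

/-- Both sides are multilinear on lines, so the case of one generator of each line suffices. -/
theorem psi_detEquiv (x' : TopExt K') (x'' : TopExt K'') (f' : TopExtDual E')
    (f'' : TopExtDual E'') :
    t.psi (m'.detEquiv (x' ⊗ₜ f') ⊗ₜ m''.detEquiv (x'' ⊗ₜ f'')) =
      (-1 : ℝ) ^ (D''.index * Module.finrank ℝ E') •
        m.detEquiv (T.wedgeK (x' ⊗ₜ x'') ⊗ₜ T.wedgeDualE (f' ⊗ₜ f'')) := by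
  obtain ⟨x₀', x₀'', f₀', f₀'', hx', hx'', hf', hf'', h⟩ := T.exists_generators
  obtain ⟨a, rfl⟩ := (finrank_eq_one_iff_of_nonzero' _ hx').1 finrank_topExt x'
  obtain ⟨b, rfl⟩ := (finrank_eq_one_iff_of_nonzero' _ hx'').1 finrank_topExt x''
  obtain ⟨c, rfl⟩ := (finrank_eq_one_iff_of_nonzero' _ hf').1
    (by rw [Subspace.dual_finrank_eq, finrank_topExt]) f'
  obtain ⟨d, rfl⟩ := (finrank_eq_one_iff_of_nonzero' _ hf'').1
    (by rw [Subspace.dual_finrank_eq, finrank_topExt]) f''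
  simp only [← TensorProduct.smul_tmul', TensorProduct.tmul_smul, map_smul, h]
  simp only [smul_smul]
  congr 1
  ring

end TripleModel

/-! ### Pure tensors of lines and the dual form of the square identity. -/

theorem exists_tmul_eq {L M : Type*} [AddCommGroup L] [Module ℝ L] [AddCommGroup M] [Module ℝ M]
    (hL : Module.finrank ℝ L = 1) (hM : Module.finrank ℝ M = 1) (z : L ⊗[ℝ] M) :
    ∃ (x : L) (y : M), x ⊗ₜ[ℝ] y = z := by
  obtain ⟨x, hx, -⟩ := finrank_eq_one_iff'.1 hL
  obtain ⟨y, hy, -⟩ := finrank_eq_one_iff'.1 hM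
  have hLM : Module.finrank ℝ (L ⊗[ℝ] M) = 1 := by rw [Module.finrank_tensorProduct, hL, hM]
  obtain ⟨c, rfl⟩ := (finrank_eq_one_iff_of_nonzero' (x ⊗ₜ[ℝ] y) (tmul_ne_zero_of_ne_zero hx hy)).1 hLM z
  exact ⟨c • x, y, by rw [TensorProduct.smul_tmul']⟩

theorem finrank_topExtDual {V : Type*} [AddCommGroup V] [Module ℝ V] [FiniteDimensional ℝ V] :
    Module.finrank ℝ (TopExtDual V) = 1 := by
  rw [Subspace.dual_finrank_eq, finrank_topExt]

/-- Evaluating both functionals on an iterated wedge reduces this to `wedge_wedge`; the sign is the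
same because it squares to one. -/
theorem wedgeDual_wedgeDual {TL TM TR CL CM CR BL BM BR : Type*}
    [AddCommGroup TL] [Module ℝ TL] [AddCommGroup TM] [Module ℝ TM] [AddCommGroup TR] [Module ℝ TR]
    [AddCommGroup CL] [Module ℝ CL] [AddCommGroup CM] [Module ℝ CM] [AddCommGroup CR] [Module ℝ CR]
    [AddCommGroup BL] [Module ℝ BL] [AddCommGroup BM] [Module ℝ BM] [AddCommGroup BR] [Module ℝ BR]
    [FiniteDimensional ℝ TM] [FiniteDimensional ℝ CM] [FiniteDimensional ℝ BM]
    [FiniteDimensional ℝ CL] [FiniteDimensional ℝ CR] [FiniteDimensional ℝ TL]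
    [FiniteDimensional ℝ TR] [FiniteDimensional ℝ BL] [FiniteDimensional ℝ BR]
    (iT : TL →ₗ[ℝ] TM) (jT : TM →ₗ[ℝ] TR) (iC : CL →ₗ[ℝ] CM) (jC : CM →ₗ[ℝ] CR)
    (iB : BL →ₗ[ℝ] BM) (jB : BM →ₗ[ℝ] BR) (iL : TL →ₗ[ℝ] CL) (jL : CL →ₗ[ℝ] BL)
    (iM : TM →ₗ[ℝ] CM) (jM : CM →ₗ[ℝ] BM) (iR : TR →ₗ[ℝ] CR) (jR : CR →ₗ[ℝ] BR)
    (hiT : Function.Injective iT) (hT : Function.Exact iT jT) (hjT : Function.Surjective jT)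
    (hiC : Function.Injective iC) (hC : Function.Exact iC jC) (hjC : Function.Surjective jC)
    (hiB : Function.Injective iB) (hB : Function.Exact iB jB) (hjB : Function.Surjective jB)
    (hiL : Function.Injective iL) (hL : Function.Exact iL jL) (hjL : Function.Surjective jL)
    (hiM : Function.Injective iM) (hM : Function.Exact iM jM) (hjM : Function.Surjective jM)
    (hiR : Function.Injective iR) (hR : Function.Exact iR jR) (hjR : Function.Surjective jR)
    (hTL : ∀ x, iM (iT x) = iC (iL x)) (hTR : ∀ x, iR (jT x) = jC (iM x))
    (hBL : ∀ x, jM (iC x) = iB (jL x)) (hBR : ∀ x, jR (jC x) = jB (jM x))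
    (f₁ : TopExtDual TL) (f₂ : TopExtDual BL) (f₃ : TopExtDual TR) (f₄ : TopExtDual BR) :
    wedgeDual iM jM hiM hM hjM (wedgeDual iT jT hiT hT hjT (f₁ ⊗ₜ f₃) ⊗ₜ
        wedgeDual iB jB hiB hB hjB (f₂ ⊗ₜ f₄)) =
      (-1 : ℝ) ^ (Module.finrank ℝ BL * Module.finrank ℝ TR) •
        wedgeDual iC jC hiC hC hjC (wedgeDual iL jL hiL hL hjL (f₁ ⊗ₜ f₂) ⊗ₜ
          wedgeDual iR jR hiR hR hjR (f₃ ⊗ₜ f₄)) := by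
  refine LinearMap.ext fun y ↦ ?_
  obtain ⟨y, rfl⟩ := (wedge iM jM hiM hM hjM).surjective y
  obtain ⟨y', y'', rfl⟩ := exists_tmul_eq finrank_topExt finrank_topExt y
  obtain ⟨y', rfl⟩ := (wedge iT jT hiT hT hjT).surjective y'
  obtain ⟨y'', rfl⟩ := (wedge iB jB hiB hB hjB).surjective y''
  obtain ⟨x₁, x₃, rfl⟩ := exists_tmul_eq finrank_topExt finrank_topExt y'
  obtain ⟨x₂, x₄, rfl⟩ := exists_tmul_eq finrank_topExt finrank_topExt y''
  rw [wedgeDual_apply_wedge, wedgeDual_apply_wedge, wedgeDual_apply_wedge,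
    wedge_wedge iT jT iC jC iB jB iL jL iM jM iR jR hiT hT hjT hiC hC hjC hiB hB hjB hiL hL hjL
      hiM hM hjM hiR hR hjR hTL hTR hBL hBR, map_smul, LinearMap.smul_apply, smul_smul, ← mul_pow,
    neg_one_mul, neg_neg, one_pow, one_smul, wedgeDual_apply_wedge, wedgeDual_apply_wedge,
    wedgeDual_apply_wedge]
  ring

theorem FiniteModel.exists_detEquiv_eq {D : FredholmOp X Y} {K E : Type*} [AddCommGroup K] [Module ℝ K] [FiniteDimensional ℝ K]
    [AddCommGroup E] [Module ℝ E] [FiniteDimensional ℝ E] (m : FiniteModel D K E)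
    (z : D.DetLine) : ∃ (x : TopExt K) (f : TopExtDual E), m.detEquiv (x ⊗ₜ f) = z := by
  obtain ⟨y, rfl⟩ := m.detEquiv.surjective z
  obtain ⟨x, f, rfl⟩ := exists_tmul_eq finrank_topExt finrank_topExtDual y
  exact ⟨x, f, rfl⟩

/-! ### The exact square in the presence of compatible models. -/

section Square

variable {XTL XTM XTR XCL XCM XCR XBL XBM XBR YTL YTM YTR YCL YCM YCR YBL YBM YBR : Type*}
    [NormedAddCommGroup XTL] [NormedSpace ℝ XTL] [CompleteSpace XTL]
    [NormedAddCommGroup XTM] [NormedSpace ℝ XTM] [CompleteSpace XTM]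
    [NormedAddCommGroup XTR] [NormedSpace ℝ XTR] [CompleteSpace XTR]
    [NormedAddCommGroup XCL] [NormedSpace ℝ XCL] [CompleteSpace XCL]
    [NormedAddCommGroup XCM] [NormedSpace ℝ XCM] [CompleteSpace XCM]
    [NormedAddCommGroup XCR] [NormedSpace ℝ XCR] [CompleteSpace XCR]
    [NormedAddCommGroup XBL] [NormedSpace ℝ XBL] [CompleteSpace XBL]
    [NormedAddCommGroup XBM] [NormedSpace ℝ XBM] [CompleteSpace XBM]
    [NormedAddCommGroup XBR] [NormedSpace ℝ XBR] [CompleteSpace XBR]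
    [NormedAddCommGroup YTL] [NormedSpace ℝ YTL] [CompleteSpace YTL]
    [NormedAddCommGroup YTM] [NormedSpace ℝ YTM] [CompleteSpace YTM]
    [NormedAddCommGroup YTR] [NormedSpace ℝ YTR] [CompleteSpace YTR]
    [NormedAddCommGroup YCL] [NormedSpace ℝ YCL] [CompleteSpace YCL]
    [NormedAddCommGroup YCM] [NormedSpace ℝ YCM] [CompleteSpace YCM]
    [NormedAddCommGroup YCR] [NormedSpace ℝ YCR] [CompleteSpace YCR]
    [NormedAddCommGroup YBL] [NormedSpace ℝ YBL] [CompleteSpace YBL]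
    [NormedAddCommGroup YBM] [NormedSpace ℝ YBM] [CompleteSpace YBM]
    [NormedAddCommGroup YBR] [NormedSpace ℝ YBR] [CompleteSpace YBR]

theorem middleSwap_tmul (D₁ : FredholmOp XTL YTL) (D₂ : FredholmOp XTM YTM)
    (D₃ : FredholmOp XTR YTR) (D₄ : FredholmOp XCL YCL) (z₁ : D₁.DetLine) (z₂ : D₂.DetLine)
    (z₃ : D₃.DetLine) (z₄ : D₄.DetLine) :
    middleSwap D₁ D₂ D₃ D₄ ((z₁ ⊗ₜ z₂) ⊗ₜ (z₃ ⊗ₜ z₄)) =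
      (-1 : ℝ) ^ (D₂.index * D₃.index) • ((z₁ ⊗ₜ z₃) ⊗ₜ (z₂ ⊗ₜ z₄)) := by
  simp only [middleSwap, gradedSwap, LinearEquiv.trans_apply, TensorProduct.assoc_tmul,
    TensorProduct.congr_tmul, TensorProduct.assoc_symm_tmul, LinearEquiv.refl_apply,
    TensorProduct.comm_tmul, signEquiv_apply, ← TensorProduct.smul_tmul', TensorProduct.tmul_smul,
    map_smul]

/-- The indices 1 to 4 stand for `TL`, `BL`, `TR`, `BR`, with `k = dim K`, `n = dim E` and `i₄ = ind
DBR`. The product `(k₂ - n₂) * (k₃ - n₃)` comes from `R`, the terms `k₂ * k₃ + n₂ * n₃` from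
interchanging the inner blocks in the `K`s and `E`s, and the remaining ones from the six uses of
`psi_detEquiv`. -/
theorem even_square_sign_sub (n₁ k₂ n₂ k₃ n₃ i₄ : ℤ) :
    Even (((k₂ - n₂) * (k₃ - n₃) + ((k₃ - n₃) * n₁ + (i₄ * n₂ +
      (((k₂ - n₂) + i₄) * (n₁ + n₃) + (k₂ * k₃ + n₂ * n₃))))) -
      ((k₂ - n₂) * n₁ + (i₄ * n₃ + ((k₃ - n₃) + i₄) * (n₁ + n₂)))) := by
  rw [← ZMod.intCast_eq_zero_iff_even]
  push_cast
  generalize (n₁ : ZMod 2) = b; revert b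
  generalize (k₂ : ZMod 2) = b; revert b
  generalize (n₂ : ZMod 2) = b; revert b
  generalize (k₃ : ZMod 2) = b; revert b
  generalize (n₃ : ZMod 2) = b; revert b
  generalize (i₄ : ZMod 2) = b; revert b
  decide

set_option maxHeartbeats 1000000 in
/-- The exact square property holds for a square of exact triples which admits compatible
finite-dimensional models. -/
theorem psi_square_of_models
    {KTL KTM KTR KCL KCM KCR KBL KBM KBR ETL ETM ETR ECL ECM ECR EBL EBM EBR : Type*}
    [AddCommGroup KTL] [Module ℝ KTL] [FiniteDimensional ℝ KTL]
    [AddCommGroup KTM] [Module ℝ KTM] [FiniteDimensional ℝ KTM]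
    [AddCommGroup KTR] [Module ℝ KTR] [FiniteDimensional ℝ KTR]
    [AddCommGroup KCL] [Module ℝ KCL] [FiniteDimensional ℝ KCL]
    [AddCommGroup KCM] [Module ℝ KCM] [FiniteDimensional ℝ KCM]
    [AddCommGroup KCR] [Module ℝ KCR] [FiniteDimensional ℝ KCR]
    [AddCommGroup KBL] [Module ℝ KBL] [FiniteDimensional ℝ KBL]
    [AddCommGroup KBM] [Module ℝ KBM] [FiniteDimensional ℝ KBM]
    [AddCommGroup KBR] [Module ℝ KBR] [FiniteDimensional ℝ KBR]
    [AddCommGroup ETL] [Module ℝ ETL] [FiniteDimensional ℝ ETL]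
    [AddCommGroup ETM] [Module ℝ ETM] [FiniteDimensional ℝ ETM]
    [AddCommGroup ETR] [Module ℝ ETR] [FiniteDimensional ℝ ETR]
    [AddCommGroup ECL] [Module ℝ ECL] [FiniteDimensional ℝ ECL]
    [AddCommGroup ECM] [Module ℝ ECM] [FiniteDimensional ℝ ECM]
    [AddCommGroup ECR] [Module ℝ ECR] [FiniteDimensional ℝ ECR]
    [AddCommGroup EBL] [Module ℝ EBL] [FiniteDimensional ℝ EBL]
    [AddCommGroup EBM] [Module ℝ EBM] [FiniteDimensional ℝ EBM]
    [AddCommGroup EBR] [Module ℝ EBR] [FiniteDimensional ℝ EBR]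
    {DTL : FredholmOp XTL YTL} {DTM : FredholmOp XTM YTM} {DTR : FredholmOp XTR YTR}
    {DCL : FredholmOp XCL YCL} {DCM : FredholmOp XCM YCM} {DCR : FredholmOp XCR YCR}
    {DBL : FredholmOp XBL YBL} {DBM : FredholmOp XBM YBM} {DBR : FredholmOp XBR YBR}
    {tT : ExactTriple DTL DTM DTR} {tC : ExactTriple DCL DCM DCR} {tB : ExactTriple DBL DBM DBR}
    {tL : ExactTriple DTL DCL DBL} {tM : ExactTriple DTM DCM DBM} {tR : ExactTriple DTR DCR DBR}
    {mTL : FiniteModel DTL KTL ETL} {mTM : FiniteModel DTM KTM ETM} {mTR : FiniteModel DTR KTR ETR}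
    {mCL : FiniteModel DCL KCL ECL} {mCM : FiniteModel DCM KCM ECM} {mCR : FiniteModel DCR KCR ECR}
    {mBL : FiniteModel DBL KBL EBL} {mBM : FiniteModel DBM KBM EBM} {mBR : FiniteModel DBR KBR EBR}
    (T : TripleModel tT mTL mTM mTR) (C : TripleModel tC mCL mCM mCR)
    (B : TripleModel tB mBL mBM mBR) (L : TripleModel tL mTL mCL mBL)
    (M : TripleModel tM mTM mCM mBM) (R : TripleModel tR mTR mCR mBR)
    (hTL_K : ∀ x, M.iK (T.iK x) = C.iK (L.iK x)) (hTL_E : ∀ x, M.iE (T.iE x) = C.iE (L.iE x))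
    (hTR_K : ∀ x, R.iK (T.jK x) = C.jK (M.iK x)) (hTR_E : ∀ x, R.iE (T.jE x) = C.jE (M.iE x))
    (hBL_K : ∀ x, M.jK (C.iK x) = B.iK (L.jK x)) (hBL_E : ∀ x, M.jE (C.iE x) = B.iE (L.jE x))
    (hBR_K : ∀ x, R.jK (C.jK x) = B.jK (M.jK x)) (hBR_E : ∀ x, R.jE (C.jE x) = B.jE (M.jE x)) :
    middleSwap DTL DBL DTR DBR ≪≫ₗ TensorProduct.congr tT.psi tB.psi ≪≫ₗ tM.psi =
      TensorProduct.congr tL.psi tR.psi ≪≫ₗ tC.psi := by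
  refine LinearEquiv.toLinearMap_injective (TensorProduct.ext_fourfold' fun z₁ z₂ z₃ z₄ ↦ ?_)
  obtain ⟨x₁, f₁, rfl⟩ := mTL.exists_detEquiv_eq z₁
  obtain ⟨x₂, f₂, rfl⟩ := mBL.exists_detEquiv_eq z₂
  obtain ⟨x₃, f₃, rfl⟩ := mTR.exists_detEquiv_eq z₃
  obtain ⟨x₄, f₄, rfl⟩ := mBR.exists_detEquiv_eq z₄
  have hK : M.wedgeK (T.wedgeK (x₁ ⊗ₜ x₃) ⊗ₜ B.wedgeK (x₂ ⊗ₜ x₄)) =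
      (-1 : ℝ) ^ (Module.finrank ℝ KBL * Module.finrank ℝ KTR) •
        C.wedgeK (L.wedgeK (x₁ ⊗ₜ x₂) ⊗ₜ R.wedgeK (x₃ ⊗ₜ x₄)) :=
    wedge_wedge _ _ _ _ _ _ _ _ _ _ _ _ _ _ _ _ _ _ _ _ _ _ _ _ _ _ _ _ _ _
      hTL_K hTR_K hBL_K hBR_K x₁ x₂ x₃ x₄
  have hE : M.wedgeDualE (T.wedgeDualE (f₁ ⊗ₜ f₃) ⊗ₜ B.wedgeDualE (f₂ ⊗ₜ f₄)) =
      (-1 : ℝ) ^ (Module.finrank ℝ EBL * Module.finrank ℝ ETR) •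
        C.wedgeDualE (L.wedgeDualE (f₁ ⊗ₜ f₂) ⊗ₜ R.wedgeDualE (f₃ ⊗ₜ f₄)) :=
    wedgeDual_wedgeDual _ _ _ _ _ _ _ _ _ _ _ _ _ _ _ _ _ _ _ _ _ _ _ _ _ _ _ _ _ _
      hTL_E hTR_E hBL_E hBR_E f₁ f₂ f₃ f₄
  have hl : (middleSwap DTL DBL DTR DBR ≪≫ₗ TensorProduct.congr tT.psi tB.psi ≪≫ₗ tM.psi)
      ((mTL.detEquiv (x₁ ⊗ₜ f₁) ⊗ₜ mBL.detEquiv (x₂ ⊗ₜ f₂)) ⊗ₜ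
        (mTR.detEquiv (x₃ ⊗ₜ f₃) ⊗ₜ mBR.detEquiv (x₄ ⊗ₜ f₄))) =
      ((-1 : ℝ) ^ (DBL.index * DTR.index) * ((-1 : ℝ) ^ (DTR.index * Module.finrank ℝ ETL) *
        ((-1 : ℝ) ^ (DBR.index * Module.finrank ℝ EBL) *
        ((-1 : ℝ) ^ (DBM.index * Module.finrank ℝ ETM) *
        ((-1 : ℝ) ^ (Module.finrank ℝ KBL * Module.finrank ℝ KTR) *
        (-1 : ℝ) ^ (Module.finrank ℝ EBL * Module.finrank ℝ ETR)))))) •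
      mCM.detEquiv (C.wedgeK (L.wedgeK (x₁ ⊗ₜ x₂) ⊗ₜ R.wedgeK (x₃ ⊗ₜ x₄)) ⊗ₜ
        C.wedgeDualE (L.wedgeDualE (f₁ ⊗ₜ f₂) ⊗ₜ R.wedgeDualE (f₃ ⊗ₜ f₄))) := by
    rw [LinearEquiv.trans_apply, LinearEquiv.trans_apply, middleSwap_tmul, map_smul, map_smul,
      TensorProduct.congr_tmul, T.psi_detEquiv, B.psi_detEquiv, ← TensorProduct.smul_tmul',
      map_smul, TensorProduct.tmul_smul, map_smul, M.psi_detEquiv, hK, hE,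
      ← TensorProduct.smul_tmul', map_smul, TensorProduct.tmul_smul, map_smul]
    simp only [smul_smul]
  have hr : (TensorProduct.congr tL.psi tR.psi ≪≫ₗ tC.psi)
      ((mTL.detEquiv (x₁ ⊗ₜ f₁) ⊗ₜ mBL.detEquiv (x₂ ⊗ₜ f₂)) ⊗ₜ
        (mTR.detEquiv (x₃ ⊗ₜ f₃) ⊗ₜ mBR.detEquiv (x₄ ⊗ₜ f₄))) =
      ((-1 : ℝ) ^ (DBL.index * Module.finrank ℝ ETL) *
        ((-1 : ℝ) ^ (DBR.index * Module.finrank ℝ ETR) *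
        (-1 : ℝ) ^ (DCR.index * Module.finrank ℝ ECL))) •
      mCM.detEquiv (C.wedgeK (L.wedgeK (x₁ ⊗ₜ x₂) ⊗ₜ R.wedgeK (x₃ ⊗ₜ x₄)) ⊗ₜ
        C.wedgeDualE (L.wedgeDualE (f₁ ⊗ₜ f₂) ⊗ₜ R.wedgeDualE (f₃ ⊗ₜ f₄))) := by
    rw [LinearEquiv.trans_apply, TensorProduct.congr_tmul, L.psi_detEquiv, R.psi_detEquiv,
      ← TensorProduct.smul_tmul', map_smul, TensorProduct.tmul_smul, map_smul, C.psi_detEquiv]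
    simp only [smul_smul]
  refine hl.trans (Eq.trans ?_ hr.symm)
  congr 1
  simp only [← zpow_natCast, ← zpow_add₀ (show (-1 : ℝ) ≠ 0 by norm_num)]
  apply neg_one_zpow_congr
  have nTE := finrank_of_ses _ _ T.iE_injective T.exactE T.jE_surjective
  have nLE := finrank_of_ses _ _ L.iE_injective L.exactE L.jE_surjective
  have nBE := finrank_of_ses _ _ B.iE_injective B.exactE B.jE_surjective
  have nRE := finrank_of_ses _ _ R.iE_injective R.exactE R.jE_surjective
  have nBK := finrank_of_ses _ _ B.iK_injective B.exactK B.jK_surjective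
  have nRK := finrank_of_ses _ _ R.iK_injective R.exactK R.jK_surjective
  -- Additivity of the index, read off from dimensions in the models, leaves only data of the corner
  -- operators in the exponents.
  have hBM : DBM.index = DBL.index + DBR.index := by
    rw [mBM.index_eq, mBL.index_eq, mBR.index_eq]; omega
  have hCR : DCR.index = DTR.index + DBR.index := by
    rw [mCR.index_eq, mTR.index_eq, mBR.index_eq]; omega
  rw [hBM, hCR, ← nTE, ← nLE, mBL.index_eq, mTR.index_eq]
  push_cast
  exact even_square_sign_sub _ _ _ _ _ _

end Square

/-! ### Models from subspaces of the targets. -/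

section Existence

/-- `E` spans the cokernel of `D`. -/
def FredholmOp.IsSpannedBy (D : FredholmOp X Y) (E : Submodule ℝ Y) : Prop :=
  ∀ y, ∃ e ∈ E, ∃ x, y = e + D.op x

theorem FredholmOp.exists_isSpannedBy (D : FredholmOp X Y) :
    ∃ E : Submodule ℝ Y, FiniteDimensional ℝ E ∧ D.IsSpannedBy E := by
  have hs := Submodule.mkQ_surjective (LinearMap.range D.lin)
  refine ⟨LinearMap.range (section_ _ hs), inferInstance, fun y ↦ ?_⟩
  obtain ⟨x, hx⟩ : y - section_ _ hs (Submodule.Quotient.mk y) ∈ LinearMap.range D.lin :=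
    (Submodule.Quotient.eq _).1 (section_spec _ hs _).symm
  refine ⟨_, LinearMap.mem_range_self _ (Submodule.Quotient.mk y), x, ?_⟩
  change y = _ + D.lin x
  rw [hx, add_sub_cancel]

/-- A subspace `E` spanning the cokernel of `D` gives the model `D⁻¹(E) → E`. -/
def FiniteModel.ofSubmodule (D : FredholmOp X Y) (E : Submodule ℝ Y) (hE : D.IsSpannedBy E) :
    FiniteModel D (E.comap D.lin) E where
  a := Submodule.inclusion (LinearMap.ker_le_comap D.lin)
  d := D.lin.restrict fun _ hx ↦ hx
  q := (LinearMap.range D.lin).mkQ ∘ₗ E.subtype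
  a_injective := Submodule.inclusion_injective _
  exact_a := by
    intro x
    constructor
    · intro h
      exact ⟨⟨x, congrArg Subtype.val h⟩, rfl⟩
    · rintro ⟨k, rfl⟩
      exact Subtype.ext k.2
  exact_q := by
    intro e
    constructor
    · intro h
      obtain ⟨x, hx⟩ := (Submodule.Quotient.mk_eq_zero _).1 h
      exact ⟨⟨x, by rw [Submodule.mem_comap, hx]; exact e.2⟩, Subtype.ext hx⟩
    · rintro ⟨x, rfl⟩
      exact (Submodule.Quotient.mk_eq_zero _).2 ⟨x, rfl⟩
  q_surjective := by
    intro y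
    obtain ⟨y, rfl⟩ := Submodule.mkQ_surjective _ y
    obtain ⟨e, he, x, rfl⟩ := hE y
    refine ⟨⟨e, he⟩, (Submodule.Quotient.eq _).2 ⟨-x, ?_⟩⟩
    change D.op (-x) = e - (e + D.op x)
    rw [map_neg]
    abel

/-- `D⁻¹(E)` is an extension of a subspace of `E` by the kernel of `D`. -/
theorem FredholmOp.finiteDimensional_comap (D : FredholmOp X Y) (E : Submodule ℝ Y)
    [FiniteDimensional ℝ E] : FiniteDimensional ℝ (E.comap D.lin) := by
  let d : E.comap D.lin →ₗ[ℝ] E := D.lin.restrict fun _ hx ↦ hx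
  have : FiniteDimensional ℝ (LinearMap.ker d) := by
    let f : LinearMap.ker d →ₗ[ℝ] D.Ker :=
      ((E.comap D.lin).subtype ∘ₗ (LinearMap.ker d).subtype).codRestrict _ fun x ↦
        congrArg Subtype.val x.2
    refine FiniteDimensional.of_injective f fun x y h ↦ ?_
    exact Subtype.ext (Subtype.ext (congrArg (fun z : D.Ker ↦ (z : X)) h))
  have : FiniteDimensional ℝ (E.comap D.lin ⧸ LinearMap.ker d) :=
    Module.Finite.equiv d.quotKerEquivRange.symm
  exact Module.Finite.of_submodule_quotient (LinearMap.ker d)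

namespace ExactTriple

variable {D' : FredholmOp X' Y'} {D : FredholmOp X Y} {D'' : FredholmOp X'' Y''}
  (t : ExactTriple D' D D'')

/-- The subspaces `E'`, `E`, `E''` of the targets form a short exact sequence. -/
structure Adapted (E' : Submodule ℝ Y') (E : Submodule ℝ Y) (E'' : Submodule ℝ Y'') : Prop where
  mem_iff : ∀ y, t.iY y ∈ E ↔ y ∈ E'
  map_mem : ∀ y ∈ E, t.jY y ∈ E''
  exists_mem : ∀ y'' ∈ E'', ∃ y ∈ E, t.jY y = y''

variable {t} {E' : Submodule ℝ Y'} {E : Submodule ℝ Y} {E'' : Submodule ℝ Y''}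

/-- The criterion behind all six adapted triples: `F` is a lift of `E''` on which `jY` is injective,
so adding `F` to the image of `E'` brings in nothing new from `Y'`. -/
theorem adapted_sup (F : Submodule ℝ Y) (hF : ∀ y ∈ F, t.jY y = 0 → y = 0)
    (hE : E = E'.map (t.iY : Y' →ₗ[ℝ] Y) ⊔ F) (hE'' : E'' = F.map (t.jY : Y →ₗ[ℝ] Y'')) :
    t.Adapted E' E E'' := by
  subst hE hE''
  refine ⟨fun y ↦ ⟨fun h ↦ ?_, fun h ↦ ?_⟩, fun y h ↦ ?_, ?_⟩
  · obtain ⟨_, ⟨e, he, rfl⟩, f, hf, h⟩ := Submodule.mem_sup.1 h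
    change t.iY e + f = t.iY y at h
    have h1 := congrArg t.jY h
    rw [map_add, t.exactY.apply_apply_eq_zero, t.exactY.apply_apply_eq_zero, zero_add] at h1
    rw [hF f hf h1, add_zero] at h
    rwa [← t.iY_injective h]
  · exact Submodule.mem_sup_left ⟨y, h, rfl⟩
  · obtain ⟨_, ⟨e, he, rfl⟩, f, hf, rfl⟩ := Submodule.mem_sup.1 h
    refine ⟨f, hf, ?_⟩
    change t.jY f = t.jY (t.iY e + f)
    rw [map_add, t.exactY.apply_apply_eq_zero, zero_add]
  · rintro _ ⟨f, hf, rfl⟩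
    exact ⟨f, Submodule.mem_sup_right hf, rfl⟩

/-- Spanning passes from the outer terms to the middle one by a diagram chase, so it has to be
arranged only at the four corners of the square. -/
theorem Adapted.isSpannedBy (h : t.Adapted E' E E'') (h' : D'.IsSpannedBy E')
    (h'' : D''.IsSpannedBy E'') : D.IsSpannedBy E := by
  intro y
  obtain ⟨e'', he'', x'', hx''⟩ := h'' (t.jY y)
  obtain ⟨e, he, rfl⟩ := h.exists_mem e'' he''
  obtain ⟨x, rfl⟩ := t.jX_surjective x''
  obtain ⟨z, hz⟩ := (t.exactY (y - e - D.op x)).1 (by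
    rw [map_sub, map_sub, hx'', ← t.comm_j_apply]
    abel)
  obtain ⟨e', he', x', rfl⟩ := h' z
  refine ⟨e + t.iY e', add_mem he ((h.mem_iff e').2 he'), x + t.iX x', ?_⟩
  rw [map_add, ← t.comm_i_apply] at hz
  rw [map_add]
  have : y = e + D.op x + (y - e - D.op x) := by abel
  rw [this, ← hz]
  abel

/-- Adapted subspaces give compatible models. -/
def Adapted.tripleModel (h : t.Adapted E' E E'') (hE' : D'.IsSpannedBy E') (hE : D.IsSpannedBy E)
    (hE'' : D''.IsSpannedBy E'') :
    TripleModel t (.ofSubmodule D' E' hE') (.ofSubmodule D E hE) (.ofSubmodule D'' E'' hE'') where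
  iK := (t.iX : X' →ₗ[ℝ] X).restrict fun x hx ↦ by
    change D.op (t.iX x) ∈ E
    rw [t.comm_i_apply]
    exact (h.mem_iff _).2 hx
  jK := (t.jX : X →ₗ[ℝ] X'').restrict fun x hx ↦ by
    change D''.op (t.jX x) ∈ E''
    rw [t.comm_j_apply]
    exact h.map_mem _ hx
  iE := (t.iY : Y' →ₗ[ℝ] Y).restrict fun y hy ↦ (h.mem_iff y).2 hy
  jE := (t.jY : Y →ₗ[ℝ] Y'').restrict fun y hy ↦ h.map_mem y hy
  iK_injective := fun _ _ e ↦ Subtype.ext (t.iX_injective (congrArg Subtype.val e))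
  exactK := by
    intro x
    constructor
    · intro hx
      obtain ⟨x', hx'⟩ := (t.exactX _).1 (congrArg Subtype.val hx : t.jX x = 0)
      refine ⟨⟨x', ?_⟩, Subtype.ext hx'⟩
      change D'.op x' ∈ E'
      rw [← h.mem_iff, ← t.comm_i_apply, hx']
      exact x.2
    · rintro ⟨x', rfl⟩
      exact Subtype.ext (t.exactX.apply_apply_eq_zero _)
  jK_surjective := by
    rintro ⟨x'', hx''⟩
    obtain ⟨x, rfl⟩ := t.jX_surjective x''
    obtain ⟨e, he, hex⟩ := h.exists_mem _ hx''
    obtain ⟨z, hz⟩ := (t.exactY (D.op x - e)).1 (by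
      rw [map_sub, ← t.comm_j_apply, hex]
      exact sub_self _)
    -- An arbitrary lift `x` need not lie in `D⁻¹(E)`: `D x - e` is the image of some `z` in `Y'`.
    -- Since `E'` spans the cokernel of `D'`, subtracting a suitable `iX x'` corrects this without
    -- changing the image in `X''`.
    obtain ⟨e', he', x', rfl⟩ := hE' z
    refine ⟨⟨x - t.iX x', ?_⟩, Subtype.ext ?_⟩
    · change D.op (x - t.iX x') ∈ E
      have : D.op (x - t.iX x') = e + t.iY e' := by
        rw [map_add] at hz
        have : D.op x = e + (D.op x - e) := by abel
        rw [map_sub, t.comm_i_apply, this, ← hz]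
        abel
      rw [this]
      exact add_mem he ((h.mem_iff _).2 he')
    · change t.jX (x - t.iX x') = t.jX x
      rw [map_sub, t.exactX.apply_apply_eq_zero, sub_zero]
  iE_injective := fun _ _ e ↦ Subtype.ext (t.iY_injective (congrArg Subtype.val e))
  exactE := by
    intro y
    constructor
    · intro hy
      obtain ⟨y', hy'⟩ := (t.exactY _).1 (congrArg Subtype.val hy : t.jY y = 0)
      refine ⟨⟨y', ?_⟩, Subtype.ext hy'⟩
      rw [← h.mem_iff, hy']
      exact y.2
    · rintro ⟨y', rfl⟩
      exact Subtype.ext (t.exactY.apply_apply_eq_zero _)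
  jE_surjective := by
    rintro ⟨y'', hy''⟩
    obtain ⟨y, hy, rfl⟩ := h.exists_mem _ hy''
    exact ⟨⟨y, hy⟩, rfl⟩
  comm_iK := fun k ↦ Subtype.ext (t.comm_i_apply k)
  comm_jK := fun k ↦ Subtype.ext (t.comm_j_apply k)
  iKer_eq := fun _ ↦ rfl
  jKer_eq := fun _ ↦ rfl
  iCoker_eq := fun _ ↦ rfl
  jCoker_eq := fun _ ↦ rfl
  delta_eq := fun _ k e hk he ↦
    SnakeLemma.δ'_eq _ _ _ _ _ _ _ _ _ _ _ _ _ _ _ _ _ _ (k : X) (congrArg Subtype.val hk) (e : Y')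
      (congrArg Subtype.val he)

end ExactTriple

end Existence

/-! ### Subspaces adapted to the whole square. -/

set_option maxHeartbeats 1000000 in
/-- Finite-dimensional subspaces of the four corner targets extend to finite-dimensional subspaces
of all nine targets that are adapted to all six exact triples. -/
theorem exists_adapted_square
    {XTL XTM XTR XCL XCM XCR XBL XBM XBR YTL YTM YTR YCL YCM YCR YBL YBM YBR : Type*}
    [NormedAddCommGroup XTL] [NormedSpace ℝ XTL] [CompleteSpace XTL]
    [NormedAddCommGroup XTM] [NormedSpace ℝ XTM] [CompleteSpace XTM]
    [NormedAddCommGroup XTR] [NormedSpace ℝ XTR] [CompleteSpace XTR]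
    [NormedAddCommGroup XCL] [NormedSpace ℝ XCL] [CompleteSpace XCL]
    [NormedAddCommGroup XCM] [NormedSpace ℝ XCM] [CompleteSpace XCM]
    [NormedAddCommGroup XCR] [NormedSpace ℝ XCR] [CompleteSpace XCR]
    [NormedAddCommGroup XBL] [NormedSpace ℝ XBL] [CompleteSpace XBL]
    [NormedAddCommGroup XBM] [NormedSpace ℝ XBM] [CompleteSpace XBM]
    [NormedAddCommGroup XBR] [NormedSpace ℝ XBR] [CompleteSpace XBR]
    [NormedAddCommGroup YTL] [NormedSpace ℝ YTL] [CompleteSpace YTL]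
    [NormedAddCommGroup YTM] [NormedSpace ℝ YTM] [CompleteSpace YTM]
    [NormedAddCommGroup YTR] [NormedSpace ℝ YTR] [CompleteSpace YTR]
    [NormedAddCommGroup YCL] [NormedSpace ℝ YCL] [CompleteSpace YCL]
    [NormedAddCommGroup YCM] [NormedSpace ℝ YCM] [CompleteSpace YCM]
    [NormedAddCommGroup YCR] [NormedSpace ℝ YCR] [CompleteSpace YCR]
    [NormedAddCommGroup YBL] [NormedSpace ℝ YBL] [CompleteSpace YBL]
    [NormedAddCommGroup YBM] [NormedSpace ℝ YBM] [CompleteSpace YBM]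
    [NormedAddCommGroup YBR] [NormedSpace ℝ YBR] [CompleteSpace YBR]
    (DTL : FredholmOp XTL YTL) (DTM : FredholmOp XTM YTM) (DTR : FredholmOp XTR YTR)
    (DCL : FredholmOp XCL YCL) (DCM : FredholmOp XCM YCM) (DCR : FredholmOp XCR YCR)
    (DBL : FredholmOp XBL YBL) (DBM : FredholmOp XBM YBM) (DBR : FredholmOp XBR YBR)
    (tT : ExactTriple DTL DTM DTR) (tC : ExactTriple DCL DCM DCR) (tB : ExactTriple DBL DBM DBR)
    (tL : ExactTriple DTL DCL DBL) (tM : ExactTriple DTM DCM DBM) (tR : ExactTriple DTR DCR DBR)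
    (cTL : ∀ y, tM.iY (tT.iY y) = tC.iY (tL.iY y)) (cTR : ∀ y, tR.iY (tT.jY y) = tC.jY (tM.iY y))
    (cBL : ∀ y, tM.jY (tC.iY y) = tB.iY (tL.jY y)) (cBR : ∀ y, tR.jY (tC.jY y) = tB.jY (tM.jY y))
    (ETL : Submodule ℝ YTL) [FiniteDimensional ℝ ETL] (ETR : Submodule ℝ YTR)
    [FiniteDimensional ℝ ETR] (EBL : Submodule ℝ YBL) [FiniteDimensional ℝ EBL]
    (EBR : Submodule ℝ YBR) [FiniteDimensional ℝ EBR] :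
    ∃ (ETM : Submodule ℝ YTM) (ECL : Submodule ℝ YCL) (ECM : Submodule ℝ YCM)
      (ECR : Submodule ℝ YCR) (EBM : Submodule ℝ YBM),
      (FiniteDimensional ℝ ETM ∧ FiniteDimensional ℝ ECL ∧ FiniteDimensional ℝ ECM ∧
        FiniteDimensional ℝ ECR ∧ FiniteDimensional ℝ EBM) ∧
      tT.Adapted ETL ETM ETR ∧ tC.Adapted ECL ECM ECR ∧ tB.Adapted EBL EBM EBR ∧
      tL.Adapted ETL ECL EBL ∧ tM.Adapted ETM ECM EBM ∧ tR.Adapted ETR ECR EBR := by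
  obtain ⟨sT, hsT⟩ : ∃ s : YTR →ₗ[ℝ] YTM, ∀ y, tT.jY (s y) = y :=
    ⟨section_ (tT.jY : YTM →ₗ[ℝ] YTR) tT.jY_surjective, section_spec _ _⟩
  obtain ⟨sL, hsL⟩ : ∃ s : YBL →ₗ[ℝ] YCL, ∀ y, tL.jY (s y) = y :=
    ⟨section_ (tL.jY : YCL →ₗ[ℝ] YBL) tL.jY_surjective, section_spec _ _⟩
  -- A single lift of `YBR` all the way to the centre. Its images in `YBM` and `YCR` supply the
  -- lifts there, which keeps the middle row and the middle column compatible.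
  obtain ⟨s, hs⟩ : ∃ s : YBR →ₗ[ℝ] YCM, ∀ y, tB.jY (tM.jY (s y)) = y :=
    ⟨section_ ((tB.jY : YBM →ₗ[ℝ] YBR) ∘ₗ (tM.jY : YCM →ₗ[ℝ] YBM))
      (tB.jY_surjective.comp tM.jY_surjective), fun y ↦ section_spec
        ((tB.jY : YBM →ₗ[ℝ] YBR) ∘ₗ (tM.jY : YCM →ₗ[ℝ] YBM)) _ y⟩
  have aT : tT.Adapted ETL (ETL.map (tT.iY : YTL →ₗ[ℝ] YTM) ⊔ ETR.map sT) ETR :=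
    ExactTriple.adapted_sup _ (by
      rintro _ ⟨y, hy, rfl⟩ h
      rw [hsT] at h
      rw [h, map_zero]) rfl (by
      rw [← Submodule.map_comp, show (tT.jY : YTM →ₗ[ℝ] YTR) ∘ₗ sT = LinearMap.id from
        LinearMap.ext hsT, Submodule.map_id])
  have aL : tL.Adapted ETL (ETL.map (tL.iY : YTL →ₗ[ℝ] YCL) ⊔ EBL.map sL) EBL :=
    ExactTriple.adapted_sup _ (by
      rintro _ ⟨y, hy, rfl⟩ h
      rw [hsL] at h
      rw [h, map_zero]) rfl (by
      rw [← Submodule.map_comp, show (tL.jY : YCL →ₗ[ℝ] YBL) ∘ₗ sL = LinearMap.id from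
        LinearMap.ext hsL, Submodule.map_id])
  have aB : tB.Adapted EBL (EBL.map (tB.iY : YBL →ₗ[ℝ] YBM) ⊔
      EBR.map ((tM.jY : YCM →ₗ[ℝ] YBM) ∘ₗ s)) EBR :=
    ExactTriple.adapted_sup _ (by
      rintro _ ⟨y, hy, rfl⟩ h
      have h' : y = 0 := (hs y).symm.trans h
      rw [h', map_zero]) rfl (by
      rw [← Submodule.map_comp, show (tB.jY : YBM →ₗ[ℝ] YBR) ∘ₗ (tM.jY : YCM →ₗ[ℝ] YBM) ∘ₗ s =
        LinearMap.id from LinearMap.ext hs, Submodule.map_id])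
  have aR : tR.Adapted ETR (ETR.map (tR.iY : YTR →ₗ[ℝ] YCR) ⊔
      EBR.map ((tC.jY : YCM →ₗ[ℝ] YCR) ∘ₗ s)) EBR :=
    ExactTriple.adapted_sup _ (by
      rintro _ ⟨y, hy, rfl⟩ h
      have h' : y = 0 := ((cBR (s y)).trans (hs y)).symm.trans h
      rw [h', map_zero]) rfl (by
      rw [← Submodule.map_comp, show (tR.jY : YCR →ₗ[ℝ] YBR) ∘ₗ (tC.jY : YCM →ₗ[ℝ] YCR) ∘ₗ s =
        LinearMap.id from LinearMap.ext fun y ↦ (cBR (s y)).trans (hs y), Submodule.map_id])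
  set ETM := ETL.map (tT.iY : YTL →ₗ[ℝ] YTM) ⊔ ETR.map sT with hETM
  set ECL := ETL.map (tL.iY : YTL →ₗ[ℝ] YCL) ⊔ EBL.map sL with hECL
  set EBM := EBL.map (tB.iY : YBL →ₗ[ℝ] YBM) ⊔ EBR.map ((tM.jY : YCM →ₗ[ℝ] YBM) ∘ₗ s) with hEBM
  set ECR := ETR.map (tR.iY : YTR →ₗ[ℝ] YCR) ⊔ EBR.map ((tC.jY : YCM →ₗ[ℝ] YCR) ∘ₗ s) with hECR
  -- The sum of the four corner contributions in `YCM`. The `TL` and `BL` parts are grouped here as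
  -- the image of `ECL`; commutativity of the top left square allows regrouping the `TL` and `TR`
  -- parts as the image of `ETM`, as the middle column needs.
  let ECM : Submodule ℝ YCM := ECL.map (tC.iY : YCL →ₗ[ℝ] YCM) ⊔
    (ETR.map ((tM.iY : YTM →ₗ[ℝ] YCM) ∘ₗ sT) ⊔ EBR.map s)
  have aC : tC.Adapted ECL ECM ECR := ExactTriple.adapted_sup _ (by
      intro _ hy h
      obtain ⟨_, ⟨y, hy, rfl⟩, _, ⟨z, hz, rfl⟩, rfl⟩ := Submodule.mem_sup.1 hy
      change tC.jY (tM.iY (sT y) + s z) = 0 at h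
      rw [map_add, ← cTR, hsT] at h
      -- Applying `tR.jY` kills the `TR` part and leaves `z = 0`; injectivity of `tR.iY` then gives
      -- `y = 0`.
      have h1 := congrArg tR.jY h
      rw [map_add, tR.exactY.apply_apply_eq_zero, cBR, hs, zero_add, map_zero] at h1
      rw [h1, map_zero, map_zero, add_zero] at h
      rw [h1, tR.iY_injective (h.trans (map_zero _).symm), map_zero, map_zero, add_zero]) rfl (by
      rw [hECR, Submodule.map_sup, ← Submodule.map_comp, ← Submodule.map_comp]
      congr 2
      ext y
      exact ((cTR _).symm.trans (congrArg tR.iY (hsT y))).symm)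
  have aM : tM.Adapted ETM ECM EBM := ExactTriple.adapted_sup
      (EBL.map ((tC.iY : YCL →ₗ[ℝ] YCM) ∘ₗ sL) ⊔ EBR.map s) (by
      intro _ hy h
      obtain ⟨_, ⟨y, hy, rfl⟩, _, ⟨z, hz, rfl⟩, rfl⟩ := Submodule.mem_sup.1 hy
      change tM.jY (tC.iY (sL y) + s z) = 0 at h
      rw [map_add, cBL, hsL] at h
      have h1 := congrArg tB.jY h
      rw [map_add, tB.exactY.apply_apply_eq_zero, hs, zero_add, map_zero] at h1
      rw [h1, map_zero, map_zero, add_zero] at h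
      rw [h1, tB.iY_injective (h.trans (map_zero _).symm), map_zero, map_zero, add_zero]) (by
      have hc : (tM.iY : YTM →ₗ[ℝ] YCM) ∘ₗ (tT.iY : YTL →ₗ[ℝ] YTM) =
          (tC.iY : YCL →ₗ[ℝ] YCM) ∘ₗ (tL.iY : YTL →ₗ[ℝ] YCL) := LinearMap.ext cTL
      simp only [ECM, hETM, hECL, Submodule.map_sup, ← Submodule.map_comp, hc]
      ac_rfl) (by
      rw [hEBM, Submodule.map_sup, ← Submodule.map_comp, ← Submodule.map_comp]
      congr 2
      ext y
      exact ((cBL _).trans (congrArg tB.iY (hsL y))).symm)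
  exact ⟨ETM, ECL, ECM, ECR, EBM, ⟨inferInstance, inferInstance, inferInstance, inferInstance,
    inferInstance⟩, aT, aC, aB, aL, aM, aR⟩

end DeterminantLine

end

/-! ### The exact square theorem. -/

set_option maxHeartbeats 1000000 in
theorem mainTheorem5
    {XTL XTM XTR XCL XCM XCR XBL XBM XBR YTL YTM YTR YCL YCM YCR YBL YBM YBR : Type*}
    [NormedAddCommGroup XTL] [NormedSpace ℝ XTL] [CompleteSpace XTL]
    [NormedAddCommGroup XTM] [NormedSpace ℝ XTM] [CompleteSpace XTM]
    [NormedAddCommGroup XTR] [NormedSpace ℝ XTR] [CompleteSpace XTR]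
    [NormedAddCommGroup XCL] [NormedSpace ℝ XCL] [CompleteSpace XCL]
    [NormedAddCommGroup XCM] [NormedSpace ℝ XCM] [CompleteSpace XCM]
    [NormedAddCommGroup XCR] [NormedSpace ℝ XCR] [CompleteSpace XCR]
    [NormedAddCommGroup XBL] [NormedSpace ℝ XBL] [CompleteSpace XBL]
    [NormedAddCommGroup XBM] [NormedSpace ℝ XBM] [CompleteSpace XBM]
    [NormedAddCommGroup XBR] [NormedSpace ℝ XBR] [CompleteSpace XBR]
    [NormedAddCommGroup YTL] [NormedSpace ℝ YTL] [CompleteSpace YTL]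
    [NormedAddCommGroup YTM] [NormedSpace ℝ YTM] [CompleteSpace YTM]
    [NormedAddCommGroup YTR] [NormedSpace ℝ YTR] [CompleteSpace YTR]
    [NormedAddCommGroup YCL] [NormedSpace ℝ YCL] [CompleteSpace YCL]
    [NormedAddCommGroup YCM] [NormedSpace ℝ YCM] [CompleteSpace YCM]
    [NormedAddCommGroup YCR] [NormedSpace ℝ YCR] [CompleteSpace YCR]
    [NormedAddCommGroup YBL] [NormedSpace ℝ YBL] [CompleteSpace YBL]
    [NormedAddCommGroup YBM] [NormedSpace ℝ YBM] [CompleteSpace YBM]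
    [NormedAddCommGroup YBR] [NormedSpace ℝ YBR] [CompleteSpace YBR]
    (DTL : FredholmOp XTL YTL) (DTM : FredholmOp XTM YTM) (DTR : FredholmOp XTR YTR)
    (DCL : FredholmOp XCL YCL) (DCM : FredholmOp XCM YCM) (DCR : FredholmOp XCR YCR)
    (DBL : FredholmOp XBL YBL) (DBM : FredholmOp XBM YBM) (DBR : FredholmOp XBR YBR)
    (tT : ExactTriple DTL DTM DTR) (tC : ExactTriple DCL DCM DCR) (tB : ExactTriple DBL DBM DBR)
    (tL : ExactTriple DTL DCL DBL) (tM : ExactTriple DTM DCM DBM) (tR : ExactTriple DTR DCR DBR)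
    (hTL_X : tM.iX ∘L tT.iX = tC.iX ∘L tL.iX) (hTL_Y : tM.iY ∘L tT.iY = tC.iY ∘L tL.iY)
    (hTR_X : tR.iX ∘L tT.jX = tC.jX ∘L tM.iX) (hTR_Y : tR.iY ∘L tT.jY = tC.jY ∘L tM.iY)
    (hBL_X : tM.jX ∘L tC.iX = tB.iX ∘L tL.jX) (hBL_Y : tM.jY ∘L tC.iY = tB.iY ∘L tL.jY)
    (hBR_X : tR.jX ∘L tC.jX = tB.jX ∘L tM.jX) (hBR_Y : tR.jY ∘L tC.jY = tB.jY ∘L tM.jY) :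
    middleSwap DTL DBL DTR DBR ≪≫ₗ TensorProduct.congr tT.psi tB.psi ≪≫ₗ tM.psi =
      TensorProduct.congr tL.psi tR.psi ≪≫ₗ tC.psi := by
  obtain ⟨ETL, _, hTL⟩ := DTL.exists_isSpannedBy
  obtain ⟨ETR, _, hTR⟩ := DTR.exists_isSpannedBy
  obtain ⟨EBL, _, hBL⟩ := DBL.exists_isSpannedBy
  obtain ⟨EBR, _, hBR⟩ := DBR.exists_isSpannedBy
  have cTL : ∀ y, tM.iY (tT.iY y) = tC.iY (tL.iY y) := DFunLike.congr_fun hTL_Y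
  have cTR : ∀ y, tR.iY (tT.jY y) = tC.jY (tM.iY y) := DFunLike.congr_fun hTR_Y
  have cBL : ∀ y, tM.jY (tC.iY y) = tB.iY (tL.jY y) := DFunLike.congr_fun hBL_Y
  have cBR : ∀ y, tR.jY (tC.jY y) = tB.jY (tM.jY y) := DFunLike.congr_fun hBR_Y
  obtain ⟨ETM, ECL, ECM, ECR, EBM, ⟨_, _, _, _, _⟩, aT, aC, aB, aL, aM, aR⟩ :=
    exists_adapted_square DTL DTM DTR DCL DCM DCR DBL DBM DBR tT tC tB tL tM tR cTL cTR cBL cBR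
      ETL ETR EBL EBR
  -- Spanning propagates from the corners to the edges, and from the edges `CL` and `CR` to the
  -- centre.
  have hTM := aT.isSpannedBy hTL hTR
  have hCL := aL.isSpannedBy hTL hBL
  have hBM := aB.isSpannedBy hBL hBR
  have hCR := aR.isSpannedBy hTR hBR
  have hCM := aC.isSpannedBy hCL hCR
  have := DTL.finiteDimensional_comap ETL
  have := DTM.finiteDimensional_comap ETM
  have := DTR.finiteDimensional_comap ETR
  have := DCL.finiteDimensional_comap ECL
  have := DCM.finiteDimensional_comap ECM
  have := DCR.finiteDimensional_comap ECR
  have := DBL.finiteDimensional_comap EBL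
  have := DBM.finiteDimensional_comap EBM
  have := DBR.finiteDimensional_comap EBR
  exact psi_square_of_models (aT.tripleModel hTL hTM hTR) (aC.tripleModel hCL hCM hCR)
    (aB.tripleModel hBL hBM hBR) (aL.tripleModel hTL hCL hBL) (aM.tripleModel hTM hCM hBM)
    (aR.tripleModel hTR hCR hBR)
    (fun x ↦ Subtype.ext (DFunLike.congr_fun hTL_X (x : XTL))) (fun y ↦ Subtype.ext (cTL y))
    (fun x ↦ Subtype.ext (DFunLike.congr_fun hTR_X (x : XTM))) (fun y ↦ Subtype.ext (cTR y))
    (fun x ↦ Subtype.ext (DFunLike.congr_fun hBL_X (x : XCL))) (fun y ↦ Subtype.ext (cBL y))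
    (fun x ↦ Subtype.ext (DFunLike.congr_fun hBR_X (x : XCM))) (fun y ↦ Subtype.ext (cBR y))
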